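/- Let $(\Omega,\mathcal F,\mu)$ be a measure space, $p\in(1,\infty)$, $k\ge 1$ an integer, and $X$ a Banach space whose norm is uniformly convex and Gâteaux differentiable (that is, $\lim_{t\to 0}\frac{\|z+tv\|-\|z\|}{t}$ exists for all $z\in X\setminus\{0\}$ and $v\in X$). Let $L^p(X)=L^p(\Omega,\mathcal F,\mu,X)$ be the Bochner space with its norm $\|\cdot\|_p$, and let $$\mathscr G_{p,k}(X)=\Big\{\sum_{i=1}^{l}x_i\mathbf 1_{A_i}\in L^p(X)\ :\ l\le k,\ \{A_i\}_{1\le i\le l}\subset\mathcal F\text{ a partition of }\Omega,\ x_1,\dots,x_l\in X\Big\}.$$ For $f\in L^p(X)$ put $\mathscr D_{p,k}(f)=\inf_{g\in\mathscr G_{p,k}(X)}\|f-g\|_p$; a sequence $(h_n)$ in $\mathscr G_{p,k}(X)$ is called minimizing for $f$ if $\|f-h_n\|_p\to\mathscr D_{p,k}(f)$, and $g\in\mathscr G_{p,k}(X)$ is called a minimizer for $f$ if $\|f-g\|_p=\mathscr D_{p,k}(f)$. Then $\mathscr G_{p,k}(X)$ is approximatively norm-compact in $L^p(X)$: for every $f\in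 L^p(X)$, every minimizing sequence for $f$ has a subnet that converges in norm to a point of $\mathscr G_{p,k}(X)$. Moreover, for every $f\in L^p(X)$, every minimizing sequence for $f$ has a subsequence that converges in norm to a minimizer for $f$. -/

import Mathlib

open MeasureTheory Filter Topology
open scoped ENNReal

/-- `kValuedSimple X p μ k` is the set `𝒢_{p,k}(X)` of (classes of) functions in `L^p(μ; X)` of the
form `∑_{i=1}^l x_i 1_{A_i}` with `l ≤ k`, a measurable partition `A_1, …, A_l` of `Ω` and
`x_1, …, x_l ∈ X`. (Empty pieces are allowed; this does not change the set.) -/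
def kValuedSimple {Ω : Type*} [MeasurableSpace Ω] (X : Type*) [NormedAddCommGroup X]
    (p : ℝ≥0∞) (μ : Measure Ω) (k : ℕ) : Set (Lp X p μ) :=
  {g | ∃ l : ℕ, l ≤ k ∧ ∃ (A : Fin l → Set Ω) (x : Fin l → X),
    (∀ i, MeasurableSet (A i)) ∧ Pairwise (fun i j => Disjoint (A i) (A j)) ∧
    (⋃ i, A i) = Set.univ ∧
    g =ᵐ[μ] fun ω => ∑ i, (A i).indicator (fun _ => x i) ω}

/-- The norm of `X` is Gâteaux differentiable: for all `z ≠ 0` and all `v`, the two-sided limit of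
`(‖z + t v‖ - ‖z‖) / t` as `t → 0` exists. (For a norm, which is convex and Lipschitz, this limit is
automatically linear and continuous in `v`.) -/
def GateauxDifferentiableNorm (X : Type*) [NormedAddCommGroup X] [NormedSpace ℝ X] : Prop :=
  ∀ z : X, z ≠ 0 → ∀ v : X, LineDifferentiableAt ℝ (fun y : X => ‖y‖) z v

/-- `w` is a minimizing sequence for `z` in `K`. -/
def IsMinimizingSeq {Z : Type*} [NormedAddCommGroup Z] (K : Set Z) (z : Z) (w : ℕ → Z) : Prop :=
  (∀ n, w n ∈ K) ∧ Tendsto (fun n => ‖z - w n‖) atTop (𝓝 (Metric.infDist z K))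

/-- `w` is a minimizer for `z` in `K`. -/
def IsMinimizer {Z : Type*} [NormedAddCommGroup Z] (K : Set Z) (z w : Z) : Prop :=
  w ∈ K ∧ ‖z - w‖ = Metric.infDist z K

/-- `K` is approximatively norm-compact: for every `z`, every minimizing sequence for `z` has
a subnet (indexed by a nonempty directed set) that converges in norm to a point of `K`. -/
def ApproximativelyNormCompact {Z : Type*} [NormedAddCommGroup Z] (K : Set Z) : Prop :=
  ∀ (z : Z) (w : ℕ → Z), IsMinimizingSeq K z w →
    ∃ (ι : Type) (_ : Preorder ι) (_ : Nonempty ι) (_ : IsDirectedOrder ι) (φ : ι → ℕ),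
      Tendsto φ atTop atTop ∧ ∃ g ∈ K, Tendsto (fun i => w (φ i)) atTop (𝓝 g)

/-! Write the `n`-th function of a minimizing sequence as `x n ∘ ι n`, with `k` values and a
measurable label map. The cells need not converge, so the values are handled first and the cells are
recovered from them.

Values. Along a subsequence the mass of each cell, and of its trace on each level set of simple
functions approximating `f`, converges in `[0, ∞]`. Cells whose mass tends to `0` are set aside. If
the mass tends to `∞`, the value tends to `0` by Chebyshev. Otherwise the value almost minimizes `z
↦ ∫_{A n} ‖f - z‖^p` on its cell; these functionals are uniformly Cauchy on bounded sets, and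
uniform convexity makes the values Cauchy (`cauchySeq_of_nearly_optimal`).

Minimizer. Relabelling every point by its nearest value gains asymptotically nothing, so along a
further subsequence `‖f - h n‖` converges a.e. to the distance to the nearest limit value. By Fatou,
the nearest-value function of the limit values is a minimizer.

Ties. Only where two distinct limit values are equally near can `h n` oscillate. For a minimizer,
any part `B` of the tie set may be moved out of the cell `A` of `x`, so `x` is optimal on both `A`
and `A \ B`. Gâteaux differentiability makes `x` critical on `A \ B`, which makes it optimal on `B`
as well; but close to `f` there are values strictly better than `x`, so the tie set is null
(`ae_not_tie`). Hence `h n` converges a.e., and convergence of the norms gives convergence in `L^p`.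
-/

/-! ### Uniform convexity of powers of the norm -/

theorem convexOn_norm_rpow {X : Type*} [NormedAddCommGroup X] [NormedSpace ℝ X] {q : ℝ}
    (hq : 1 ≤ q) : ConvexOn ℝ Set.univ (fun u : X => ‖u‖ ^ q) := by
  refine ⟨convex_univ, fun u _ v _ a b ha hb hab => ?_⟩
  calc ‖a • u + b • v‖ ^ q ≤ (a * ‖u‖ + b * ‖v‖) ^ q := by
        refine Real.rpow_le_rpow (norm_nonneg _) ?_ (by linarith)
        refine (norm_add_le _ _).trans_eq ?_
        rw [norm_smul, norm_smul, Real.norm_of_nonneg ha, Real.norm_of_nonneg hb]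
    _ ≤ a • ‖u‖ ^ q + b • ‖v‖ ^ q :=
        (convexOn_rpow hq).2 (norm_nonneg u) (norm_nonneg v) ha hb hab

theorem norm_midpoint_rpow_le {X : Type*} [NormedAddCommGroup X] [NormedSpace ℝ X] {q : ℝ}
    (hq : 1 ≤ q) (u v : X) :
    ‖(2⁻¹ : ℝ) • (u + v)‖ ^ q ≤ (‖u‖ ^ q + ‖v‖ ^ q) / 2 := by
  have := (convexOn_norm_rpow (X := X) hq).2 (Set.mem_univ u) (Set.mem_univ v)
    (by norm_num : (0 : ℝ) ≤ 2⁻¹) (by norm_num : (0 : ℝ) ≤ 2⁻¹) (by norm_num)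
  simp only [smul_eq_mul, ← smul_add] at this
  linarith

/-- Strict convexity of `t ^ q` gives a positive gap off the diagonal; compactness makes it uniform.
-/
theorem exists_midpoint_rpow_add_le {q : ℝ} (hq : 1 < q) (R : ℝ) {τ : ℝ} (hτ : 0 < τ) :
    ∃ c > 0, ∀ a b : ℝ, 0 ≤ a → a ≤ R → 0 ≤ b → b ≤ R → τ ≤ |a - b| →
      ((a + b) / 2) ^ q + c ≤ (a ^ q + b ^ q) / 2 := by
  let K : Set (ℝ × ℝ) := (Set.Icc 0 R ×ˢ Set.Icc 0 R) ∩ {z | τ ≤ |z.1 - z.2|}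
  have hK : IsCompact K :=
    (isCompact_Icc.prod isCompact_Icc).inter_right
      (isClosed_le continuous_const (by fun_prop))
  rcases K.eq_empty_or_nonempty with h | h
  · refine ⟨1, one_pos, fun a b ha haR hb hbR hab => ?_⟩
    have : (a, b) ∈ K := ⟨⟨⟨ha, haR⟩, hb, hbR⟩, hab⟩
    simp [h] at this
  have hq0 : 0 ≤ q := by linarith
  obtain ⟨z, hz, hmin⟩ := hK.exists_isMinOn (f := fun z : ℝ × ℝ =>
    (z.1 ^ q + z.2 ^ q) / 2 - ((z.1 + z.2) / 2) ^ q) h (by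
      apply Continuous.continuousOn
      have := Real.continuous_rpow_const hq0
      fun_prop)
  refine ⟨(z.1 ^ q + z.2 ^ q) / 2 - ((z.1 + z.2) / 2) ^ q, ?_, fun a b ha haR hb hbR hab => ?_⟩
  rotate_left 1
  · have := hmin (show (a, b) ∈ K from ⟨⟨⟨ha, haR⟩, hb, hbR⟩, hab⟩)
    simp only [Set.mem_ofPred_eq] at this
    rw [← le_sub_iff_add_le']
    exact this
  · obtain ⟨⟨⟨h1, -⟩, h2, -⟩, h3⟩ := hz
    have hne : z.1 ≠ z.2 := by
      intro h; simp [h] at h3; linarith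
    have := (strictConvexOn_rpow hq).2 (show z.1 ∈ Set.Ici 0 from h1) (show z.2 ∈ Set.Ici 0 from h2)
      hne (by norm_num : (0 : ℝ) < 2⁻¹) (by norm_num : (0 : ℝ) < 2⁻¹) (by norm_num)
    simp only [smul_eq_mul] at this
    have e : 2⁻¹ * z.1 + 2⁻¹ * z.2 = (z.1 + z.2) / 2 := by ring
    rw [e] at this
    simp only [gt_iff_lt, sub_pos]
    linarith

/-- On bounded sets, the `q`-th power of a uniformly convex norm, `1 < q`, is uniformly convex. -/
theorem exists_norm_midpoint_rpow_add_le {X : Type*} [NormedAddCommGroup X] [NormedSpace ℝ X]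
    [UniformConvexSpace X] {q : ℝ} (hq : 1 < q) {R : ℝ} (hR : 0 < R) {ε : ℝ} (hε : 0 < ε) :
    ∃ c > 0, ∀ u v : X, ‖u‖ ≤ R → ‖v‖ ≤ R → ε ≤ ‖u - v‖ →
      ‖(2⁻¹ : ℝ) • (u + v)‖ ^ q + c ≤ (‖u‖ ^ q + ‖v‖ ^ q) / 2 := by
  have hq0 : 0 < q := by linarith
  obtain ⟨δ', hδ', hδ''⟩ := exists_forall_closed_ball_dist_add_le_two_sub X (div_pos hε hR)
  -- Capping `δ` at `1` keeps `1 - δ / 2` and `1 - δ / 4` nonnegative as bases of powers.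
  obtain ⟨δ, hδ0, hδ1, hδ⟩ : ∃ δ : ℝ, 0 < δ ∧ δ ≤ 1 ∧ ∀ ⦃x : X⦄, ‖x‖ ≤ 1 → ∀ ⦃y⦄, ‖y‖ ≤ 1 →
      ε / R ≤ ‖x - y‖ → ‖x + y‖ ≤ 2 - δ :=
    ⟨min δ' 1, by positivity, min_le_right _ _, fun x hx y hy hxy =>
      (hδ'' hx hy hxy).trans (by linarith [min_le_left δ' 1])⟩
  obtain ⟨c, hc, H⟩ := exists_midpoint_rpow_add_le hq R (τ := δ * ε / 8) (by positivity)
  set d := ((1 - δ / 4) ^ q - (1 - δ / 2) ^ q) * (ε / 2) ^ q with hd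
  have hlt : (1 - δ / 2) ^ q < (1 - δ / 4) ^ q :=
    Real.rpow_lt_rpow (by linarith) (by linarith) hq0
  have hd0 : 0 < d := mul_pos (by linarith) (by positivity)
  refine ⟨min c d, lt_min hc hd0, fun u v hu hv huv => ?_⟩
  -- Either the norms differ enough for strict convexity of `t ^ q`, or, after division by the
  -- larger norm `M`, the midpoint shrinks to at most `1 - δ / 2`. In the second case `M ≥ ε / 2`,
  -- so both norms are at least `M - δ * ε / 8 ≥ (1 - δ / 4) * M`.
  rcases le_or_gt (δ * ε / 8) |‖u‖ - ‖v‖| with h | h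
  · have h1 := H ‖u‖ ‖v‖ (norm_nonneg _) hu (norm_nonneg _) hv h
    have h2 : ‖(2⁻¹ : ℝ) • (u + v)‖ ^ q ≤ ((‖u‖ + ‖v‖) / 2) ^ q := by
      refine Real.rpow_le_rpow (norm_nonneg _) ?_ hq0.le
      rw [norm_smul, Real.norm_of_nonneg (by norm_num)]
      linarith [norm_add_le u v]
    linarith [min_le_left c d]
  · set M := max ‖u‖ ‖v‖ with hM
    have hMε : ε / 2 ≤ M := by
      have := norm_sub_le u v
      linarith [le_max_left ‖u‖ ‖v‖, le_max_right ‖u‖ ‖v‖]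
    have hM0 : 0 < M := by linarith
    have hMR : M ≤ R := max_le hu hv
    have hscale : ∀ w : X, ‖M⁻¹ • w‖ = ‖w‖ / M := fun w => by
      rw [norm_smul, Real.norm_of_nonneg (by positivity)]; field_simp
    have h1 : ‖u + v‖ / M ≤ 2 - δ := by
      rw [← hscale, smul_add]
      refine hδ ?_ ?_ ?_
      · rw [hscale, div_le_one hM0]; exact le_max_left _ _
      · rw [hscale, div_le_one hM0]; exact le_max_right _ _
      · rw [← smul_sub, hscale]
        exact div_le_div₀ (norm_nonneg _) huv hM0 hMR
    rw [div_le_iff₀ hM0] at h1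
    have h2 : ‖(2⁻¹ : ℝ) • (u + v)‖ ^ q ≤ (1 - δ / 2) ^ q * M ^ q := by
      rw [← Real.mul_rpow (by linarith) hM0.le]
      refine Real.rpow_le_rpow (norm_nonneg _) ?_ hq0.le
      rw [norm_smul, Real.norm_of_nonneg (by norm_num)]
      linarith
    have h3 : ∀ w : ℝ, M - δ * ε / 8 ≤ w → (1 - δ / 4) ^ q * M ^ q ≤ w ^ q := fun w hw => by
      rw [← Real.mul_rpow (by linarith) hM0.le]
      refine Real.rpow_le_rpow (mul_nonneg (by linarith) hM0.le) ?_ hq0.le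
      nlinarith
    have hab := abs_lt.1 h
    have hu' : M - δ * ε / 8 ≤ ‖u‖ := by
      rw [sub_le_iff_le_add]; exact max_le (by linarith [mul_pos hδ0 hε]) (by linarith)
    have hv' : M - δ * ε / 8 ≤ ‖v‖ := by
      rw [sub_le_iff_le_add]; exact max_le (by linarith) (by linarith [mul_pos hδ0 hε])
    have h4 := h3 _ hu'
    have h5 := h3 _ hv'
    have h6 : d ≤ ((1 - δ / 4) ^ q - (1 - δ / 2) ^ q) * M ^ q :=
      mul_le_mul_of_nonneg_left (Real.rpow_le_rpow (by positivity) hMε hq0.le) (by linarith)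
    rw [sub_mul] at h6
    linarith [min_le_right c d]

/-! ### Directional derivatives of powers of the norm -/

theorem GateauxDifferentiableNorm.exists_hasDerivAt_norm_rpow {X : Type*} [NormedAddCommGroup X]
    [NormedSpace ℝ X] (hX : GateauxDifferentiableNorm X) {q : ℝ} (hq : 1 < q) (u v : X) :
    ∃ d, HasDerivAt (fun t : ℝ => ‖u + t • v‖ ^ q) d 0 := by
  rcases eq_or_ne u 0 with rfl | hu
  · have h := (hasDerivAt_abs_rpow 0 hq).mul_const (‖v‖ ^ q)
    refine ⟨_, h.congr_of_eventuallyEq (Eventually.of_forall fun t => ?_)⟩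
    simp only [zero_add, norm_smul, Real.norm_eq_abs]
    exact Real.mul_rpow (abs_nonneg _) (norm_nonneg _)
  · have h : HasDerivAt (fun t : ℝ => ‖u + t • v‖) _ 0 := (hX u hu v).hasLineDerivAt
    exact ⟨_, h.rpow_const (Or.inl (by simpa using hu))⟩

/-- The slopes from the two sides cancel. By convexity this symmetric quotient is nonnegative, which
makes it convenient under an integral. -/
theorem GateauxDifferentiableNorm.tendsto_symm_quotient {X : Type*} [NormedAddCommGroup X]
    [NormedSpace ℝ X] (hX : GateauxDifferentiableNorm X) {q : ℝ} (hq : 1 < q) (u v : X) :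
    Tendsto (fun n : ℕ => ((n : ℝ) + 1) * (‖u + ((n : ℝ) + 1)⁻¹ • v‖ ^ q
      + ‖u - ((n : ℝ) + 1)⁻¹ • v‖ ^ q - 2 * ‖u‖ ^ q)) atTop (𝓝 0) := by
  obtain ⟨d, hd⟩ := hX.exists_hasDerivAt_norm_rpow hq u v
  have h0 : Tendsto (fun n : ℕ => ((n : ℝ) + 1)⁻¹) atTop (𝓝 0) := by
    simpa [one_div] using tendsto_one_div_add_atTop_nhds_zero_nat (𝕜 := ℝ)
  have hpos : ∀ n : ℕ, ((n : ℝ) + 1)⁻¹ ≠ 0 := fun n => by positivity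
  have h := hd.tendsto_slope_zero
  have h1 := h.comp (tendsto_nhdsWithin_iff.2 ⟨h0, Eventually.of_forall hpos⟩)
  have h2 := h.comp (tendsto_nhdsWithin_iff.2 ⟨by simpa using h0.neg,
    Eventually.of_forall fun n => neg_ne_zero.2 (hpos n)⟩)
  have h3 := h1.sub h2
  rw [sub_self] at h3
  refine h3.congr fun n => ?_
  simp only [Function.comp, smul_eq_mul, zero_add, zero_smul, add_zero, neg_smul, inv_inv, inv_neg]
  rw [← sub_eq_add_neg u]
  ring

/-! ### Almost everywhere convergence and convergence of integrals -/

/-- A sequence in `L^p` that converges almost everywhere and whose norms converge to the norm of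
the limit converges in `L^p`. -/
theorem tendsto_integral_norm_sub_rpow {Ω : Type*} [MeasurableSpace Ω] {μ : Measure Ω}
    {X : Type*} [NormedAddCommGroup X] {q : ℝ} (hq : 1 ≤ q)
    {F : ℕ → Ω → X} {G : Ω → X} (hF : ∀ n, AEStronglyMeasurable (F n) μ)
    (hG : AEStronglyMeasurable G μ)
    (hFi : ∀ n, Integrable (fun ω => ‖F n ω‖ ^ q) μ) (hGi : Integrable (fun ω => ‖G ω‖ ^ q) μ)
    (hae : ∀ᵐ ω ∂μ, Tendsto (fun n => F n ω) atTop (𝓝 (G ω)))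
    (hint : Tendsto (fun n => ∫ ω, ‖F n ω‖ ^ q ∂μ) atTop (𝓝 (∫ ω, ‖G ω‖ ^ q ∂μ))) :
    Tendsto (fun n => ∫ ω, ‖F n ω - G ω‖ ^ q ∂μ) atTop (𝓝 0) := by
  have hq0 : 0 < q := by linarith
  set C : ℝ := 2 ^ (q - 1) with hC
  have hC0 : 0 < C := by positivity
  have hcont := Real.continuous_rpow_const hq0.le
  have hmF : ∀ n, AEStronglyMeasurable (fun ω => ‖F n ω‖ ^ q) μ := fun n =>
    hcont.comp_aestronglyMeasurable (hF n).norm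
  have hmG : AEStronglyMeasurable (fun ω => ‖G ω‖ ^ q) μ := hcont.comp_aestronglyMeasurable hG.norm
  have hmS : ∀ n, AEStronglyMeasurable (fun ω => ‖F n ω - G ω‖ ^ q) μ := fun n =>
    hcont.comp_aestronglyMeasurable ((hF n).sub hG).norm
  have hbd : ∀ n ω, ‖F n ω - G ω‖ ^ q ≤ C * (‖F n ω‖ ^ q + ‖G ω‖ ^ q) := fun n ω => by
    refine (Real.rpow_le_rpow (norm_nonneg _) (norm_sub_le _ _) hq0.le).trans ?_
    exact_mod_cast NNReal.rpow_add_le_mul_rpow_add_rpow ‖F n ω‖₊ ‖G ω‖₊ hq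
  have haeq : ∀ᵐ ω ∂μ, Tendsto (fun n => ‖F n ω‖ ^ q) atTop (𝓝 (‖G ω‖ ^ q)) :=
    hae.mono fun ω h => h.norm.rpow_const (Or.inr hq0.le)
  -- Truncation at `2 * C * ‖G‖ ^ q` allows dominated convergence. The part cut off is at most `C`
  -- times the positive part of `‖F n‖ ^ q - ‖G‖ ^ q`, written below as `a + max (-a) 0`; its
  -- integral vanishes by `hint` and dominated convergence.
  have h1 : Tendsto (fun n => ∫ ω, min (‖F n ω - G ω‖ ^ q) (2 * C * ‖G ω‖ ^ q) ∂μ) atTop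
      (𝓝 (∫ _, (0 : ℝ) ∂μ)) := by
    refine tendsto_integral_of_dominated_convergence (fun ω => 2 * C * ‖G ω‖ ^ q)
      (fun n => (hmS n).inf (hmG.const_mul _)) (hGi.const_mul _) (fun n => ?_) ?_
    · refine Eventually.of_forall fun ω => ?_
      rw [Real.norm_of_nonneg (by positivity)]
      exact min_le_right _ _
    · filter_upwards [hae] with ω h
      have h2 : Tendsto (fun n => ‖F n ω - G ω‖ ^ q) atTop (𝓝 0) := by
        have := ((h.sub_const (G ω)).norm).rpow_const (p := q) (Or.inr hq0.le)
        simpa [hq0.ne'] using this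
      have := h2.min (tendsto_const_nhds (x := 2 * C * ‖G ω‖ ^ q))
      rwa [min_eq_left (by positivity)] at this
  have h2 : Tendsto (fun n => ∫ ω, max (‖G ω‖ ^ q - ‖F n ω‖ ^ q) 0 ∂μ) atTop
      (𝓝 (∫ _, (0 : ℝ) ∂μ)) := by
    refine tendsto_integral_of_dominated_convergence (fun ω => ‖G ω‖ ^ q)
      (fun n => (hmG.sub (hmF n)).sup aestronglyMeasurable_const) hGi (fun n => ?_) ?_
    · refine Eventually.of_forall fun ω => ?_
      rw [Real.norm_of_nonneg (le_max_right _ _)]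
      have : 0 ≤ ‖F n ω‖ ^ q := by positivity
      exact max_le (by linarith) (by positivity)
    · filter_upwards [haeq] with ω h
      simpa using (h.const_sub (‖G ω‖ ^ q)).max (tendsto_const_nhds (x := (0 : ℝ)))
  have h3 : Tendsto (fun n => (∫ ω, ‖F n ω‖ ^ q ∂μ) - ∫ ω, ‖G ω‖ ^ q ∂μ) atTop (𝓝 0) := by
    simpa using hint.sub_const (∫ ω, ‖G ω‖ ^ q ∂μ)
  have h4 := h1.add ((h3.add h2).const_mul C)
  simp only [integral_zero, add_zero, mul_zero] at h4
  refine squeeze_zero (fun n => by positivity) (fun n => ?_) h4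
  have i1 : Integrable (fun ω => max (‖G ω‖ ^ q - ‖F n ω‖ ^ q) 0) μ :=
    (hGi.sub (hFi n)).pos_part
  have i2 : Integrable (fun ω => ‖F n ω - G ω‖ ^ q) μ := by
    refine (((hFi n).add hGi).const_mul C).mono' (hmS n) (Eventually.of_forall fun ω => ?_)
    rw [Real.norm_of_nonneg (by positivity)]
    exact hbd n ω
  have i3 : Integrable (fun ω => min (‖F n ω - G ω‖ ^ q) (2 * C * ‖G ω‖ ^ q)) μ :=
    i2.inf (hGi.const_mul _)
  have i4 : Integrable (fun ω => ‖F n ω‖ ^ q - ‖G ω‖ ^ q) μ := (hFi n).sub hGi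
  have i5 : Integrable (fun ω => C * (‖F n ω‖ ^ q - ‖G ω‖ ^ q
      + max (‖G ω‖ ^ q - ‖F n ω‖ ^ q) 0)) μ := (i4.add i1).const_mul C
  rw [← integral_sub (hFi n) hGi, ← integral_add i4 i1, ← integral_const_mul,
    ← integral_add i3 i5]
  refine integral_mono i2 (i3.add i5) fun ω => ?_
  have hb := hbd n ω
  beta_reduce
  rcases le_total (‖F n ω - G ω‖ ^ q) (2 * C * ‖G ω‖ ^ q) with h | h
  · rw [min_eq_left h]
    have : 0 ≤ ‖F n ω‖ ^ q - ‖G ω‖ ^ q + max (‖G ω‖ ^ q - ‖F n ω‖ ^ q) 0 := by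
      linarith [le_max_left (‖G ω‖ ^ q - ‖F n ω‖ ^ q) 0]
    nlinarith
  · rw [min_eq_right h]
    have := le_max_right (‖G ω‖ ^ q - ‖F n ω‖ ^ q) 0
    nlinarith

/-- Along a subsequence the integrals are summable, so the series of functions is finite a.e. -/
theorem exists_subseq_tendsto_zero_ae {Ω : Type*} [MeasurableSpace Ω] {μ : Measure Ω}
    {v : ℕ → Ω → ℝ≥0∞} (hv : ∀ n, AEMeasurable (v n) μ)
    (h : Tendsto (fun n => ∫⁻ ω, v n ω ∂μ) atTop (𝓝 0)) :
    ∃ φ : ℕ → ℕ, StrictMono φ ∧ ∀ᵐ ω ∂μ, Tendsto (fun n => v (φ n) ω) atTop (𝓝 0) := by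
  obtain ⟨ε, hε, hsum⟩ := ENNReal.exists_pos_sum_of_countable one_ne_zero ℕ
  obtain ⟨φ, hφ, hle⟩ := extraction_forall_of_eventually
    (P := fun n m => ∫⁻ ω, v m ω ∂μ < ε n)
    (fun n => h.eventually_lt_const (by simpa using hε n))
  refine ⟨φ, hφ, ?_⟩
  have hfin : ∫⁻ ω, ∑' n, v (φ n) ω ∂μ ≠ ∞ := by
    rw [lintegral_tsum fun n => hv (φ n)]
    exact ((ENNReal.tsum_le_tsum fun n => (hle n).le).trans_lt
      (hsum.trans ENNReal.one_lt_top)).ne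
  filter_upwards [ae_lt_top' (AEMeasurable.tsum fun n => hv (φ n)) hfin] with ω hω
  exact ENNReal.tendsto_atTop_zero_of_tsum_ne_top hω.ne

/-! ### Label maps for `k`-valued functions -/

theorem exists_measurable_argmin {Ω : Type*} [MeasurableSpace Ω] {k : ℕ} (hk : 1 ≤ k)
    {a : Fin k → Ω → ℝ} (ha : ∀ i, Measurable (a i)) :
    ∃ κ : Ω → Fin k, Measurable κ ∧ ∀ ω i, a (κ ω) ω ≤ a i ω := by
  classical
  have : Nonempty (Fin k) := ⟨⟨0, hk⟩⟩
  have hex : ∀ ω, ∃ n, ∃ h : n < k, ∀ i, a ⟨n, h⟩ ω ≤ a i ω := fun ω => by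
    obtain ⟨i, hi⟩ := Finite.exists_min fun i => a i ω
    exact ⟨i, i.2, hi⟩
  -- Taking the smallest minimizing index makes the choice measurable.
  have hmeas : Measurable fun ω => Nat.find (hex ω) := measurable_find hex fun n => by
    by_cases h : n < k
    · simp only [h, exists_true_left]
      rw [Set.ofPred_forall]
      exact MeasurableSet.iInter fun i => measurableSet_le (ha _) (ha i)
    · simp [h]
  refine ⟨fun ω => ⟨Nat.find (hex ω), (Nat.find_spec (hex ω)).1⟩, ?_,
    fun ω => (Nat.find_spec (hex ω)).2⟩
  refine measurable_to_countable' fun i => ?_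
  convert hmeas (measurableSet_singleton (i : ℕ)) using 1
  ext ω
  simp [Fin.ext_iff]

theorem mem_kValuedSimple_iff {Ω : Type*} [MeasurableSpace Ω] {X : Type*} [NormedAddCommGroup X]
    {p : ℝ≥0∞} {μ : Measure Ω} {k : ℕ} {g : Lp X p μ} :
    g ∈ kValuedSimple X p μ k ↔ ∃ (ι : Ω → Fin k) (x : Fin k → X), Measurable ι ∧
      g =ᵐ[μ] fun ω => x (ι ω) := by
  classical
  constructor
  · rintro ⟨l, hl, A, x, hA, hdis, hun, hg⟩
    have hex : ∀ ω, ∃ i, ω ∈ A i := fun ω => by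
      exact Set.mem_iUnion.1 (hun ▸ Set.mem_univ ω)
    choose j hj using hex
    have huniq : ∀ ω i, ω ∈ A i ↔ j ω = i := fun ω i =>
      ⟨fun h => by
        by_contra hne
        exact Set.disjoint_left.1 (hdis hne) (hj ω) h, fun h => h ▸ hj ω⟩
    -- Labels from `l` on have empty fibres, so the padding value `0` is never taken.
    refine ⟨fun ω => Fin.castLE hl (j ω), fun i => if h : (i : ℕ) < l then x ⟨i, h⟩ else 0, ?_, ?_⟩
    · refine (measurable_from_top (f := Fin.castLE hl)).comp (measurable_to_countable' fun i => ?_)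
      convert hA i using 1
      ext ω
      simp [huniq]
    · refine hg.trans (Eventually.of_forall fun ω => ?_)
      simp [Set.indicator_apply, huniq]
  · rintro ⟨ι, x, hι, hg⟩
    refine ⟨k, le_rfl, fun i => ι ⁻¹' {i}, x, fun i => hι (measurableSet_singleton i),
      fun i j hij => ?_, ?_, ?_⟩
    · exact Disjoint.preimage _ (by simpa using hij)
    · ext; simp
    · refine hg.trans (Eventually.of_forall fun ω => ?_)
      simp [Set.indicator_apply]

/-! ### The functionals `x ↦ ∫_A ‖f - x‖^p` and their near minimizers -/

theorem MeasureTheory.MemLp.lpNorm_rpow_eq_integral {Ω : Type*} [MeasurableSpace Ω]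
    {μ : Measure Ω} {X : Type*} [NormedAddCommGroup X] {p : ℝ≥0∞} (hp0 : p ≠ 0) (hp : p ≠ ∞)
    {F : Ω → X} (hF : MemLp F p μ) : lpNorm F p μ ^ p.toReal = ∫ ω, ‖F ω‖ ^ p.toReal ∂μ := by
  rw [lpNorm_eq_integral_norm_rpow_toReal hp0 hp hF.1, ← Real.rpow_mul (by positivity),
    inv_mul_cancel₀ (ENNReal.toReal_pos hp0 hp).ne', Real.rpow_one]

theorem memLp_restrict_sub_const {Ω : Type*} [MeasurableSpace Ω]
    {μ : Measure Ω} {X : Type*} [NormedAddCommGroup X] {p : ℝ≥0∞} {f : Ω → X}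
    (hf : MemLp f p μ) {A : Set Ω} (hA : μ A ≠ ∞) (x : X) :
    MemLp (fun ω => f ω - x) p (μ.restrict A) := by
  have : Fact (μ A < ∞) := ⟨hA.lt_top⟩
  exact (hf.restrict A).sub (memLp_const x)

theorem integrableOn_norm_sub_const_rpow {Ω : Type*} [MeasurableSpace Ω]
    {μ : Measure Ω} {X : Type*} [NormedAddCommGroup X] {p : ℝ≥0∞} (hp0 : p ≠ 0) (hp : p ≠ ∞)
    {f : Ω → X} (hf : MemLp f p μ) {A : Set Ω} (hA : μ A ≠ ∞) (x : X) :
    IntegrableOn (fun ω => ‖f ω - x‖ ^ p.toReal) A μ :=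
  (memLp_restrict_sub_const hf hA x).integrable_norm_rpow hp0 hp

/-- For simple `s` the integral sees `A` only through finitely many masses, so convergence of these
masses replaces convergence of the sets. -/
theorem setIntegral_comp_simpleFunc {Ω : Type*} [MeasurableSpace Ω] {μ : Measure Ω}
    {X : Type*} (s : SimpleFunc Ω X) (G : X → ℝ) {A : Set Ω} (hA : μ A ≠ ∞) :
    ∫ ω in A, G (s ω) ∂μ = ∑ y ∈ s.range, μ.real (A ∩ s ⁻¹' {y}) * G y := by
  classical
  have : Fact (μ A < ∞) := ⟨hA.lt_top⟩
  have h : ∀ ω, G (s ω) = ∑ y ∈ s.range, (s ⁻¹' {y}).indicator (fun _ => G y) ω := fun ω => by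
    rw [Finset.sum_eq_single (s ω)]
    · simp
    · intro y _ hy
      simp [hy.symm]
    · intro hy
      exact absurd (s.mem_range_self ω) hy
  simp_rw [h]
  rw [integral_finsetSum]
  · refine Finset.sum_congr rfl fun y _ => ?_
    rw [integral_indicator_const _ (s.measurableSet_fiber y), smul_eq_mul,
      measureReal_restrict_apply (s.measurableSet_fiber y), Set.inter_comm]
  · exact fun y _ => (integrable_const _).indicator (s.measurableSet_fiber y)

theorem abs_lpNorm_sub_lpNorm_le {Ω : Type*} [MeasurableSpace Ω] {μ : Measure Ω}
    {X : Type*} [NormedAddCommGroup X] {p : ℝ≥0∞} (hp : 1 ≤ p) {F G : Ω → X}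
    (hF : MemLp F p μ) (hG : MemLp G p μ) :
    |lpNorm F p μ - lpNorm G p μ| ≤ lpNorm (F - G) p μ := by
  have h1 := lpNorm_add_le (g := G) (hF.sub hG) hp
  have h2 := lpNorm_add_le (g := F) (hG.sub hF) hp
  rw [sub_add_cancel] at h1 h2
  rw [lpNorm_sub_comm G F] at h2
  exact abs_le.2 ⟨by linarith, by linarith⟩

theorem lpNorm_restrict_le {Ω : Type*} [MeasurableSpace Ω] {μ : Measure Ω}
    {X : Type*} [NormedAddCommGroup X] {p : ℝ≥0∞} {F : Ω → X} (hF : MemLp F p μ) (A : Set Ω) :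
    lpNorm F p (μ.restrict A) ≤ lpNorm F p μ := by
  rw [← toReal_eLpNorm hF.1, ← toReal_eLpNorm hF.1.restrict]
  exact ENNReal.toReal_mono hF.2.ne (eLpNorm_restrict_le _ _ _ _)

/-- If the measures of the traces of `A n` on the level sets of simple functions approximating `f`
in `L^p` converge, then the functionals `x ↦ ∫_{A n} ‖f - x‖^p` are uniformly Cauchy on bounded
sets. -/
theorem exists_forall_abs_setIntegral_sub_le {Ω : Type*} [MeasurableSpace Ω] {μ : Measure Ω}
    {X : Type*} [NormedAddCommGroup X] {p : ℝ≥0∞} (hp1 : 1 ≤ p) (hp : p ≠ ∞)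
    {f : Ω → X} (hf : MemLp f p μ) {s : ℕ → SimpleFunc Ω X} (hs : ∀ j, MemLp (s j) p μ)
    (hsf : Tendsto (fun j => lpNorm (f - ⇑(s j)) p μ) atTop (𝓝 0))
    {A : ℕ → Set Ω} {M : ℝ≥0∞} (hM : M ≠ ∞) (hA : ∀ᶠ n in atTop, μ (A n) ≤ M)
    (hconv : ∀ j, ∀ y ∈ (s j).range, ∃ c, Tendsto (fun n => μ (A n ∩ s j ⁻¹' {y})) atTop (𝓝 c))
    (R : ℝ) {ε : ℝ} (hε : 0 < ε) :
    ∃ N, ∀ n ≥ N, ∀ m ≥ N, ∀ x : X, ‖x‖ ≤ R →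
      |∫ ω in A n, ‖f ω - x‖ ^ p.toReal ∂μ - ∫ ω in A m, ‖f ω - x‖ ^ p.toReal ∂μ| ≤ ε := by
  have hp0 : p ≠ 0 := (zero_lt_one.trans_le hp1).ne'
  set q := p.toReal with hq
  have hq0 : 0 < q := ENNReal.toReal_pos hp0 hp
  wlog hR : 0 ≤ R generalizing R
  · exact ⟨0, fun n _ m _ x hx => absurd ((norm_nonneg x).trans hx) hR⟩
  -- A bound for the `L^p` norms of `f - x` and `s j - x` on `A n`; the `+ 1` pays for replacing `f`
  -- by `s j`.
  set C := lpNorm f p μ + R * M.toReal ^ q⁻¹ + 1 with hC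
  have huc : UniformContinuousOn (fun t : ℝ => t ^ q) (Set.Icc 0 C) :=
    isCompact_Icc.uniformContinuousOn_of_continuous
      (Real.continuous_rpow_const hq0.le).continuousOn
  obtain ⟨δ, hδ, hδC⟩ := Metric.uniformContinuousOn_iff.1 huc (ε / 4) (by positivity)
  obtain ⟨j, hj⟩ := (hsf.eventually_lt_const (lt_min hδ one_pos)).exists
  have happrox : ∀ n, μ (A n) ≤ M → ∀ x : X, ‖x‖ ≤ R →
      |∫ ω in A n, ‖f ω - x‖ ^ q ∂μ - ∫ ω in A n, ‖s j ω - x‖ ^ q ∂μ| ≤ ε / 4 := by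
    intro n hn x hx
    have hfin : μ (A n) ≠ ∞ := (hn.trans_lt hM.lt_top).ne
    have : Fact (μ (A n) < ∞) := ⟨hfin.lt_top⟩
    have m1 := memLp_restrict_sub_const hf hfin x
    have m2 := memLp_restrict_sub_const (hs j) hfin x
    rw [← m1.lpNorm_rpow_eq_integral hp0 hp, ← m2.lpNorm_rpow_eq_integral hp0 hp, ← hq]
    have h1 := abs_lpNorm_sub_lpNorm_le hp1 m1 m2
    have e : (fun ω => f ω - x) - (fun ω => s j ω - x) = f - s j := by ext ω; simp
    rw [e] at h1
    have h2 := h1.trans_lt ((lpNorm_restrict_le (hf.sub (hs j)) (A n)).trans_lt hj)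
    have h3 : lpNorm (fun ω => f ω - x) p (μ.restrict (A n)) ≤ C - 1 := by
      have h := lpNorm_sub_le (g := fun _ => x) (hf.restrict (A n)) hp1
      refine h.trans ?_
      rw [hC, add_sub_cancel_right, lpNorm_const' hp0 hp, measureReal_restrict_apply_univ]
      refine add_le_add (lpNorm_restrict_le hf _) (mul_le_mul hx ?_ (by positivity) hR)
      exact Real.rpow_le_rpow (by positivity) (ENNReal.toReal_mono hM hn) (by positivity)
    have h4 := abs_lt.1 (h2.trans_le (min_le_right _ _))
    refine (hδC _ ⟨lpNorm_nonneg, by linarith⟩ _ ⟨lpNorm_nonneg, by linarith⟩ ?_).le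
    exact h2.trans_le (min_le_left _ _)
  set S := ∑ y ∈ (s j).range, (‖y‖ + R) ^ q with hS
  have hS0 : 0 ≤ S := Finset.sum_nonneg fun y _ => by positivity
  set η := ε / (4 * (S + 1)) with hη
  have hη0 : 0 < η := by positivity
  have hmass : ∀ᶠ n in atTop, ∀ y ∈ (s j).range,
      |μ.real (A n ∩ s j ⁻¹' {y}) - ((limUnder atTop fun n => μ (A n ∩ s j ⁻¹' {y})).toReal)|
        < η := by
    rw [Finset.eventually_all]
    intro y hy
    obtain ⟨c, hc⟩ := hconv j y hy
    have hcM : c ≤ M := le_of_tendsto hc (hA.mono fun n hn =>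
      (measure_mono Set.inter_subset_left).trans hn)
    rw [hc.limUnder_eq]
    have := (ENNReal.tendsto_toReal (hcM.trans_lt hM.lt_top).ne).comp hc
    exact Metric.tendsto_nhds.1 this η hη0
  obtain ⟨N, hN⟩ := eventually_atTop.1 (hA.and hmass)
  refine ⟨N, fun n hn m hm x hx => ?_⟩
  obtain ⟨hAn, hn⟩ := hN n hn
  obtain ⟨hAm, hm⟩ := hN m hm
  have e1 := happrox n hAn x hx
  have e2 := happrox m hAm x hx
  have e3 : |∫ ω in A n, ‖s j ω - x‖ ^ q ∂μ - ∫ ω in A m, ‖s j ω - x‖ ^ q ∂μ| ≤ ε / 2 := by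
    rw [setIntegral_comp_simpleFunc (s j) (fun y => ‖y - x‖ ^ q) (hAn.trans_lt hM.lt_top).ne,
      setIntegral_comp_simpleFunc (s j) (fun y => ‖y - x‖ ^ q) (hAm.trans_lt hM.lt_top).ne,
      ← Finset.sum_sub_distrib]
    refine (Finset.abs_sum_le_sum_abs _ _).trans ?_
    calc _ ≤ ∑ y ∈ (s j).range, (2 * η) * (‖y‖ + R) ^ q := by
          refine Finset.sum_le_sum fun y hy => ?_
          rw [← sub_mul, abs_mul, abs_of_nonneg (by positivity : 0 ≤ ‖y - x‖ ^ q)]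
          refine mul_le_mul ?_ ?_ (by positivity) (by positivity)
          · have h1 := abs_lt.1 (hn y hy)
            have h2 := abs_lt.1 (hm y hy)
            exact abs_le.2 ⟨by linarith, by linarith⟩
          · exact Real.rpow_le_rpow (norm_nonneg _)
              ((norm_sub_le _ _).trans (by gcongr)) hq0.le
      _ = (2 * η) * S := by rw [hS, Finset.mul_sum]
      _ ≤ 2 * η * (S + 1) := by gcongr; linarith
      _ = ε / 2 := by rw [hη]; field_simp; ring
  have h1 := abs_le.1 e1
  have h2 := abs_le.1 e2
  have h3 := abs_le.1 e3
  exact abs_le.2 ⟨by linarith, by linarith⟩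

theorem MeasureTheory.MemLp.tendsto_measure_ge_zero {Ω : Type*} [MeasurableSpace Ω]
    {μ : Measure Ω} {X : Type*} [NormedAddCommGroup X] {p : ℝ≥0∞} (hp0 : p ≠ 0) (hp : p ≠ ∞)
    {f : Ω → X} (hf : MemLp f p μ) (hfm : StronglyMeasurable f) :
    Tendsto (fun n : ℕ => μ {ω | (n : ℝ) + 1 ≤ ‖f ω‖}) atTop (𝓝 0) := by
  have hmeas : ∀ n : ℕ, MeasurableSet {ω | (n : ℝ) + 1 ≤ ‖f ω‖} := fun n =>
    measurableSet_le measurable_const hfm.norm.measurable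
  have h := tendsto_measure_iInter_atTop (μ := μ) (s := fun n : ℕ => {ω | (n : ℝ) + 1 ≤ ‖f ω‖})
    (fun n => (hmeas n).nullMeasurableSet) (fun m n hmn ω (hω : (n : ℝ) + 1 ≤ ‖f ω‖) =>
      (show (m : ℝ) + 1 ≤ ‖f ω‖ from le_trans (by gcongr) hω)) ⟨0, ?_⟩
  · have e : (⋂ n : ℕ, {ω | (n : ℝ) + 1 ≤ ‖f ω‖}) = ∅ := by
      refine Set.eq_empty_of_forall_notMem fun ω hω => ?_
      obtain ⟨n, hn⟩ := exists_nat_gt ‖f ω‖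
      have : (n : ℝ) + 1 ≤ ‖f ω‖ := Set.mem_iInter.1 hω n
      linarith
    rwa [e, measure_empty] at h
  · have := hf.meas_ge_lt_top' hp0 hp (ε := 1) one_ne_zero
    refine (lt_of_le_of_lt (measure_mono fun ω hω => ?_) this).ne
    have : (0 : ℝ) + 1 ≤ ‖f ω‖ := by simpa using hω
    simpa [← NNReal.coe_le_coe] using this

/-- The gain `c` is available only where `f` is bounded; elsewhere plain convexity is used. -/
theorem setIntegral_midpoint_add_le {Ω : Type*} [MeasurableSpace Ω] {μ : Measure Ω}
    {X : Type*} [NormedAddCommGroup X] [NormedSpace ℝ X] {p : ℝ≥0∞} (hp1 : 1 ≤ p) (hp : p ≠ ∞)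
    {f : Ω → X} (hf : MemLp f p μ) (hfm : StronglyMeasurable f) {A : Set Ω} (hA : μ A ≠ ∞)
    {a b : X} {r c : ℝ} (hc : ∀ ω, ‖f ω‖ < r → ‖(2⁻¹ : ℝ) • ((f ω - a) + (f ω - b))‖ ^ p.toReal + c
      ≤ (‖f ω - a‖ ^ p.toReal + ‖f ω - b‖ ^ p.toReal) / 2) :
    ∫ ω in A, ‖f ω - (2⁻¹ : ℝ) • (a + b)‖ ^ p.toReal ∂μ + c * μ.real (A ∩ {ω | ‖f ω‖ < r})
      ≤ (∫ ω in A, ‖f ω - a‖ ^ p.toReal ∂μ + ∫ ω in A, ‖f ω - b‖ ^ p.toReal ∂μ) / 2 := by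
  have hp0 : p ≠ 0 := (zero_lt_one.trans_le hp1).ne'
  have : Fact (μ A < ∞) := ⟨hA.lt_top⟩
  have hq1 : 1 ≤ p.toReal := by
    simpa using ENNReal.toReal_mono hp hp1
  have hS : MeasurableSet {ω | ‖f ω‖ < r} :=
    measurableSet_lt hfm.norm.measurable measurable_const
  have i := fun x => integrableOn_norm_sub_const_rpow hp0 hp hf hA x
  have i0 : IntegrableOn ({ω | ‖f ω‖ < r}.indicator fun _ => c) A μ :=
    (integrable_const c).indicator hS
  have e : c * μ.real (A ∩ {ω | ‖f ω‖ < r})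
      = ∫ ω in A, {ω | ‖f ω‖ < r}.indicator (fun _ => c) ω ∂μ := by
    rw [integral_indicator_const _ hS, smul_eq_mul, measureReal_restrict_apply hS, Set.inter_comm,
      mul_comm]
  rw [e, ← integral_add (i _) i0, ← integral_add (i a) (i b), ← integral_div]
  refine integral_mono ((i _).add i0) (((i a).add (i b)).div_const 2) fun ω => ?_
  have e2 : f ω - (2⁻¹ : ℝ) • (a + b) = (2⁻¹ : ℝ) • ((f ω - a) + (f ω - b)) := by module
  simp only [e2]
  by_cases h : ‖f ω‖ < r
  · rw [Set.indicator_of_mem (by exact h)]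
    exact hc ω h
  · rw [Set.indicator_of_notMem (by exact h), add_zero]
    exact norm_midpoint_rpow_le hq1 _ _

/-- Near minimizers of the functionals `x ↦ ∫_{A n} ‖f - x‖^p` form a Cauchy sequence. -/
theorem cauchySeq_of_nearly_optimal {Ω : Type*} [MeasurableSpace Ω] {μ : Measure Ω}
    {X : Type*} [NormedAddCommGroup X] [NormedSpace ℝ X] [UniformConvexSpace X]
    {p : ℝ≥0∞} (hp1 : 1 < p) (hp : p ≠ ∞)
    {f : Ω → X} (hf : MemLp f p μ) (hfm : StronglyMeasurable f)
    {s : ℕ → SimpleFunc Ω X} (hs : ∀ j, MemLp (s j) p μ)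
    (hsf : Tendsto (fun j => lpNorm (f - ⇑(s j)) p μ) atTop (𝓝 0))
    {A : ℕ → Set Ω} {M m₀ : ℝ≥0∞} (hM : M ≠ ∞) (hA : ∀ᶠ n in atTop, μ (A n) ≤ M)
    (hm₀ : m₀ ≠ 0) (hA' : ∀ᶠ n in atTop, m₀ ≤ μ (A n))
    (hconv : ∀ j, ∀ y ∈ (s j).range, ∃ c, Tendsto (fun n => μ (A n ∩ s j ⁻¹' {y})) atTop (𝓝 c))
    {x : ℕ → X} {R : ℝ} (hx : ∀ᶠ n in atTop, ‖x n‖ ≤ R)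
    {η : ℕ → ℝ} (hη : Tendsto η atTop (𝓝 0))
    (hopt : ∀ᶠ n in atTop, ∀ z, ∫ ω in A n, ‖f ω - x n‖ ^ p.toReal ∂μ
      ≤ ∫ ω in A n, ‖f ω - z‖ ^ p.toReal ∂μ + η n) :
    CauchySeq x := by
  have hp0 : p ≠ 0 := (zero_lt_one.trans hp1).ne'
  have hq1 : 1 < p.toReal := by
    simpa using (ENNReal.toReal_lt_toReal ENNReal.one_ne_top hp).2 hp1
  have hm₀top : m₀ ≠ ∞ := by
    obtain ⟨n, h1, h2⟩ := (hA.and hA').exists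
    exact ((h2.trans h1).trans_lt hM.lt_top).ne
  -- Large values of `f` occupy less than half of the minimal mass `m₀`, so the convexity gain acts
  -- on mass at least `m₀ / 2`. With `R ≤ j`, all differences there have norm at most `2 * r`.
  obtain ⟨j, hj, hjR⟩ : ∃ j : ℕ, μ {ω | (j : ℝ) + 1 ≤ ‖f ω‖} < m₀ / 2 ∧ R ≤ j := by
    obtain ⟨j₀, hj₀⟩ := exists_nat_ge R
    obtain ⟨j, h1, h2⟩ := (((hf.tendsto_measure_ge_zero hp0 hp hfm).eventually_lt_const
      (ENNReal.half_pos hm₀)).and (eventually_ge_atTop j₀)).exists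
    exact ⟨j, h1, hj₀.trans (by exact_mod_cast h2)⟩
  set r : ℝ := (j : ℝ) + 1 with hr
  have hr0 : 0 < r := by positivity
  have hbulk : ∀ n, m₀ ≤ μ (A n) → μ (A n) ≠ ∞ →
      m₀.toReal / 2 ≤ μ.real (A n ∩ {ω | ‖f ω‖ < r}) := by
    intro n hn hfin
    have h1 : μ (A n) ≤ μ (A n ∩ {ω | ‖f ω‖ < r}) + m₀ / 2 := by
      refine le_trans ((measure_mono ?_).trans (measure_union_le _ {ω | r ≤ ‖f ω‖}))
        (by gcongr)
      intro ω hω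
      rcases lt_or_ge ‖f ω‖ r with h | h
      · exact Or.inl ⟨hω, h⟩
      · exact Or.inr h
    have h2 : μ (A n ∩ {ω | ‖f ω‖ < r}) ≠ ∞ :=
      ((measure_mono Set.inter_subset_left).trans_lt hfin.lt_top).ne
    have h4 : m₀ / 2 ≠ ∞ := ENNReal.div_ne_top hm₀top two_ne_zero
    have h3 := ENNReal.toReal_mono (ENNReal.add_ne_top.2 ⟨h2, h4⟩) (hn.trans h1)
    rw [ENNReal.toReal_add h2 h4, ENNReal.toReal_div, ENNReal.toReal_ofNat] at h3
    rw [Measure.real]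
    linarith
  have hm₀pos : 0 < m₀.toReal := ENNReal.toReal_pos hm₀ hm₀top
  refine Metric.cauchySeq_iff.2 fun ε hε => ?_
  obtain ⟨c, hc, hconvex⟩ := exists_norm_midpoint_rpow_add_le (X := X) hq1
    (R := 2 * r) (by positivity) hε
  -- If `x n` and `x m` are far apart, the midpoint gains `γ` on `A n`. Near-optimality of `x n` and
  -- `x m` and two exchanges between `A n` and `A m` cost at most `γ / 4` each, and the average
  -- halves the total: `γ ≤ γ / 2`.
  set γ := c * (m₀.toReal / 2) with hγ
  have hγ0 : 0 < γ := by positivity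
  obtain ⟨N₁, hN₁⟩ := exists_forall_abs_setIntegral_sub_le hp1.le hp hf hs hsf hM hA hconv R
    (show 0 < γ / 4 by positivity)
  obtain ⟨N₂, hN₂⟩ := eventually_atTop.1 (hA.and (hA'.and (hx.and (hopt.and
    (hη.eventually_lt_const (show 0 < γ / 4 by positivity))))))
  refine ⟨max N₁ N₂, fun n hn m hm => ?_⟩
  obtain ⟨a1, a2, a3, a4, a5⟩ := hN₂ n (le_of_max_le_right hn)
  obtain ⟨b1, b2, b3, b4, b5⟩ := hN₂ m (le_of_max_le_right hm)
  have hnm := hN₁ n (le_of_max_le_left hn) m (le_of_max_le_left hm)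
  by_contra! hfar
  rw [dist_eq_norm] at hfar
  have hfin : μ (A n) ≠ ∞ := (a1.trans_lt hM.lt_top).ne
  have hz : ‖(2⁻¹ : ℝ) • (x n + x m)‖ ≤ R := by
    rw [norm_smul, Real.norm_of_nonneg (by norm_num)]
    linarith [norm_add_le (x n) (x m)]
  have key := setIntegral_midpoint_add_le hp1.le hp hf hfm hfin (a := x n) (b := x m) (r := r)
    (c := c) fun ω hω => hconvex _ _
      ((norm_sub_le _ _).trans (by linarith)) ((norm_sub_le _ _).trans (by linarith))
      (by rwa [sub_sub_sub_cancel_left, norm_sub_rev])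
  have h1 := mul_le_mul_of_nonneg_left (hbulk n a2 hfin) hc.le
  have h2 := a4 ((2⁻¹ : ℝ) • (x n + x m))
  have h3 := b4 ((2⁻¹ : ℝ) • (x n + x m))
  have h4 := abs_le.1 (hnm _ b3)
  have h5 := abs_le.1 (hnm _ hz)
  rw [← hγ] at h1
  linarith

/-! ### Optimality of each value on its cell -/

theorem stronglyMeasurable_comp_of_finite {Ω : Type*} [MeasurableSpace Ω] {X : Type*}
    [TopologicalSpace X] {k : ℕ} (x : Fin k → X) {ι : Ω → Fin k} (hι : Measurable ι) :
    StronglyMeasurable fun ω => x (ι ω) :=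
  StronglyMeasurable.of_discrete.comp_measurable hι

theorem memLp_of_norm_sub_le {Ω : Type*} [MeasurableSpace Ω] {μ : Measure Ω}
    {X : Type*} [NormedAddCommGroup X] {p : ℝ≥0∞} {f g h : Ω → X} (hf : MemLp f p μ)
    (hg : MemLp g p μ) (hh : AEStronglyMeasurable h μ)
    (hle : ∀ᵐ ω ∂μ, ‖f ω - h ω‖ ≤ ‖f ω - g ω‖) : MemLp h p μ := by
  have h1 : MemLp (f - h) p μ := (hf.sub hg).mono (hf.1.sub hh) hle
  simpa using hf.sub h1

theorem enorm_rpow_mul_measure_fiber_le {Ω : Type*} [MeasurableSpace Ω] {μ : Measure Ω}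
    {X : Type*} [NormedAddCommGroup X] {p : ℝ≥0∞} (hp0 : p ≠ 0) (hp : p ≠ ∞) {k : ℕ}
    {ι : Ω → Fin k} {x : Fin k → X} (hmem : MemLp (fun ω => x (ι ω)) p μ) (i : Fin k) :
    ‖x i‖ₑ ^ p.toReal * μ (ι ⁻¹' {i}) ≤ eLpNorm (fun ω => x (ι ω)) p μ ^ p.toReal := by
  refine le_trans ?_ (mul_meas_ge_le_pow_eLpNorm' μ hp0 hp hmem.1 ‖x i‖ₑ)
  gcongr
  intro ω (hω : ι ω = i)
  simp [hω]

theorem measure_fiber_ne_top {Ω : Type*} [MeasurableSpace Ω] {μ : Measure Ω}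
    {X : Type*} [NormedAddCommGroup X] {p : ℝ≥0∞} (hp0 : p ≠ 0) (hp : p ≠ ∞) {k : ℕ}
    {ι : Ω → Fin k} {x : Fin k → X} (hmem : MemLp (fun ω => x (ι ω)) p μ) {i : Fin k}
    (hi : x i ≠ 0) : μ (ι ⁻¹' {i}) ≠ ∞ := by
  intro h
  have h1 := enorm_rpow_mul_measure_fiber_le hp0 hp hmem i
  have h2 : ‖x i‖ₑ ^ p.toReal ≠ 0 := by
    simp [hi]
  rw [h, ENNReal.mul_top h2, top_le_iff] at h1
  exact (ENNReal.rpow_lt_top_of_nonneg (by positivity) hmem.2.ne).ne h1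

theorem memLp_update {Ω : Type*} [MeasurableSpace Ω] {μ : Measure Ω}
    {X : Type*} [NormedAddCommGroup X] {p : ℝ≥0∞} {k : ℕ} {ι : Ω → Fin k} (hι : Measurable ι)
    {x : Fin k → X} (hmem : MemLp (fun ω => x (ι ω)) p μ) {i : Fin k} (hi : μ (ι ⁻¹' {i}) ≠ ∞)
    (z : X) : MemLp (fun ω => Function.update x i z (ι ω)) p μ := by
  have h := hmem.add (memLp_indicator_const p (hι (measurableSet_singleton i)) (z - x i)
    (Or.inr hi))
  convert h using 1
  ext ω
  by_cases hω : ι ω = i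
  · simp [hω]
  · simp [hω]

/-- Each value of a function whose distance to `f` is almost optimal among `k`-valued functions is
almost optimal for `f` on its level set. -/
theorem setIntegral_fiber_le {Ω : Type*} [MeasurableSpace Ω] {μ : Measure Ω}
    {X : Type*} [NormedAddCommGroup X] {p : ℝ≥0∞} (hp0 : p ≠ 0) (hp : p ≠ ∞) {k : ℕ}
    {f : Ω → X} (hf : MemLp f p μ) {D : ℝ}
    (hD : ∀ (κ : Ω → Fin k) (y : Fin k → X), Measurable κ → MemLp (fun ω => y (κ ω)) p μ →
      D ≤ ∫ ω, ‖f ω - y (κ ω)‖ ^ p.toReal ∂μ)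
    {ι : Ω → Fin k} (hι : Measurable ι) {x : Fin k → X} (hmem : MemLp (fun ω => x (ι ω)) p μ)
    {i : Fin k} (hi : μ (ι ⁻¹' {i}) ≠ ∞) (z : X) :
    ∫ ω in ι ⁻¹' {i}, ‖f ω - x i‖ ^ p.toReal ∂μ ≤ ∫ ω in ι ⁻¹' {i}, ‖f ω - z‖ ^ p.toReal ∂μ
      + (∫ ω, ‖f ω - x (ι ω)‖ ^ p.toReal ∂μ - D) := by
  have hA : MeasurableSet (ι ⁻¹' {i}) := hι (measurableSet_singleton i)
  -- The competitor keeps the cells and changes only the `i`-th value to `z`.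
  have hmem' := memLp_update hι hmem hi z
  have h := hD ι _ hι hmem'
  have i1 : Integrable (fun ω => ‖f ω - x (ι ω)‖ ^ p.toReal) μ :=
    (hf.sub hmem).integrable_norm_rpow hp0 hp
  have i2 : Integrable (fun ω => ‖f ω - Function.update x i z (ι ω)‖ ^ p.toReal) μ :=
    (hf.sub hmem').integrable_norm_rpow hp0 hp
  rw [← integral_add_compl hA i2] at h
  rw [← integral_add_compl hA i1]
  have e1 : ∫ ω in ι ⁻¹' {i}, ‖f ω - Function.update x i z (ι ω)‖ ^ p.toReal ∂μ
      = ∫ ω in ι ⁻¹' {i}, ‖f ω - z‖ ^ p.toReal ∂μ :=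
    setIntegral_congr_fun hA fun ω (hω : ι ω = i) => by simp [hω]
  have e2 : ∫ ω in ι ⁻¹' {i}, ‖f ω - x (ι ω)‖ ^ p.toReal ∂μ
      = ∫ ω in ι ⁻¹' {i}, ‖f ω - x i‖ ^ p.toReal ∂μ :=
    setIntegral_congr_fun hA fun ω (hω : ι ω = i) => by simp [hω]
  have e3 : ∫ ω in (ι ⁻¹' {i})ᶜ, ‖f ω - Function.update x i z (ι ω)‖ ^ p.toReal ∂μ
      = ∫ ω in (ι ⁻¹' {i})ᶜ, ‖f ω - x (ι ω)‖ ^ p.toReal ∂μ :=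
    setIntegral_congr_fun hA.compl fun ω (hω : ι ω ≠ i) => by simp [hω]
  rw [e1, e3] at h
  rw [e2]
  linarith

/-! ### Ties are negligible for a minimizer -/

/-- If `x` minimizes `z ↦ ∫_A ‖f - z‖^p`, then this functional is differentiable at `x`, with zero
derivative in every direction `v`. -/
theorem tendsto_setIntegral_quotient {Ω : Type*} [MeasurableSpace Ω] {μ : Measure Ω}
    {X : Type*} [NormedAddCommGroup X] [NormedSpace ℝ X] (hX : GateauxDifferentiableNorm X)
    {p : ℝ≥0∞} (hp1 : 1 < p) (hp : p ≠ ∞)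
    {f : Ω → X} (hf : MemLp f p μ) {A : Set Ω} (hA : μ A ≠ ∞) {x : X}
    (hx : ∀ z, ∫ ω in A, ‖f ω - x‖ ^ p.toReal ∂μ ≤ ∫ ω in A, ‖f ω - z‖ ^ p.toReal ∂μ) (v : X) :
    Tendsto (fun n : ℕ => ((n : ℝ) + 1) * (∫ ω in A, ‖f ω - (x - ((n : ℝ) + 1)⁻¹ • v)‖ ^ p.toReal ∂μ
      - ∫ ω in A, ‖f ω - x‖ ^ p.toReal ∂μ)) atTop (𝓝 0) := by
  have hp0 : p ≠ 0 := (zero_lt_one.trans hp1).ne'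
  have hq1 : 1 < p.toReal := by
    simpa using (ENNReal.toReal_lt_toReal ENNReal.one_ne_top hp).2 hp1
  set q := p.toReal
  have i : ∀ z, IntegrableOn (fun ω => ‖f ω - z‖ ^ q) A μ := fun z =>
    integrableOn_norm_sub_const_rpow hp0 hp hf hA z
  -- Minimality of `x` makes both one-sided differences nonnegative after integration, so the
  -- symmetric quotient bounds the one in question. Convexity supplies a dominating function
  -- independent of `n`.
  set S : ℕ → Ω → ℝ := fun n ω => ((n : ℝ) + 1) * (‖f ω - (x - ((n : ℝ) + 1)⁻¹ • v)‖ ^ q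
    + ‖f ω - (x + ((n : ℝ) + 1)⁻¹ • v)‖ ^ q - 2 * ‖f ω - x‖ ^ q) with hS
  have iS : ∀ n, IntegrableOn (S n) A μ := fun n =>
    (((i _).add (i _)).sub ((i x).const_mul 2)).const_mul _
  have hconv : ∀ (u w : X) (n : ℕ), ‖u + ((n : ℝ) + 1)⁻¹ • w‖ ^ q
      ≤ (1 - ((n : ℝ) + 1)⁻¹) * ‖u‖ ^ q + ((n : ℝ) + 1)⁻¹ * ‖u + w‖ ^ q := fun u w n => by
    have ht : ((n : ℝ) + 1)⁻¹ ≤ 1 := inv_le_one_of_one_le₀ (by linarith [n.cast_nonneg (α := ℝ)])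
    have := (convexOn_norm_rpow (X := X) hq1.le).2 (Set.mem_univ u) (Set.mem_univ (u + w))
      (sub_nonneg.2 ht) (by positivity : (0 : ℝ) ≤ ((n : ℝ) + 1)⁻¹) (by ring)
    have e : (1 - ((n : ℝ) + 1)⁻¹) • u + ((n : ℝ) + 1)⁻¹ • (u + w) = u + ((n : ℝ) + 1)⁻¹ • w := by
      module
    simpa only [e, smul_eq_mul] using this
  have hnonneg : ∀ n ω, 0 ≤ S n ω := fun n ω => by
    have h := norm_midpoint_rpow_le hq1.le (f ω - (x - ((n : ℝ) + 1)⁻¹ • v))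
      (f ω - (x + ((n : ℝ) + 1)⁻¹ • v))
    have e : (2⁻¹ : ℝ) • ((f ω - (x - ((n : ℝ) + 1)⁻¹ • v)) + (f ω - (x + ((n : ℝ) + 1)⁻¹ • v)))
      = f ω - x := by module
    rw [e] at h
    exact mul_nonneg (by positivity) (by linarith)
  have hbound : ∀ n ω, S n ω ≤ ‖f ω - (x - v)‖ ^ q + ‖f ω - (x + v)‖ ^ q := fun n ω => by
    have h1 := hconv (f ω - x) v n
    have h2 := hconv (f ω - x) (-v) n
    have e1 : f ω - x + ((n : ℝ) + 1)⁻¹ • v = f ω - (x - ((n : ℝ) + 1)⁻¹ • v) := by abel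
    have e2 : f ω - x + ((n : ℝ) + 1)⁻¹ • (-v) = f ω - (x + ((n : ℝ) + 1)⁻¹ • v) := by module
    have e3 : f ω - x + v = f ω - (x - v) := by abel
    have e4 : f ω - x + -v = f ω - (x + v) := by abel
    rw [e1, e3] at h1
    rw [e2, e4] at h2
    have hn : (0 : ℝ) < (n : ℝ) + 1 := by positivity
    have h0 : 0 ≤ ‖f ω - x‖ ^ q := by positivity
    calc S n ω ≤ ((n : ℝ) + 1) * (((n : ℝ) + 1)⁻¹ *
          (‖f ω - (x - v)‖ ^ q + ‖f ω - (x + v)‖ ^ q)) := by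
          refine mul_le_mul_of_nonneg_left ?_ hn.le
          have : 0 ≤ ((n : ℝ) + 1)⁻¹ * ‖f ω - x‖ ^ q := by positivity
          linarith
      _ = _ := by rw [← mul_assoc, mul_inv_cancel₀ hn.ne', one_mul]
  have hlim : Tendsto (fun n => ∫ ω in A, S n ω ∂μ) atTop (𝓝 (∫ _ in A, (0 : ℝ) ∂μ)) := by
    refine tendsto_integral_of_dominated_convergence _ (fun n => (iS n).1)
      ((i (x - v)).add (i (x + v))) (fun n => Eventually.of_forall fun ω => ?_)
      (Eventually.of_forall fun ω => ?_)
    · rw [Real.norm_of_nonneg (hnonneg n ω)]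
      exact hbound n ω
    · refine (hX.tendsto_symm_quotient hq1 (f ω - x) v).congr fun n => ?_
      simp only [hS, sub_add, sub_sub]
  rw [integral_zero] at hlim
  refine squeeze_zero (fun n => mul_nonneg (by positivity) (sub_nonneg.2 (hx _))) (fun n => ?_) hlim
  have i2 : IntegrableOn (fun ω => ‖f ω - (x - ((n : ℝ) + 1)⁻¹ • v)‖ ^ q
      + ‖f ω - (x + ((n : ℝ) + 1)⁻¹ • v)‖ ^ q) A μ := (i _).add (i _)
  simp only [hS]
  rw [integral_const_mul, integral_sub i2 ((i x).const_mul 2),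
    integral_add (i _) (i _), integral_const_mul]
  refine mul_le_mul_of_nonneg_left ?_ (by positivity)
  linarith [hx (x + ((n : ℝ) + 1)⁻¹ • v)]

theorem measure_eq_zero_of_setIntegral_le {Ω : Type*} [MeasurableSpace Ω] {μ : Measure Ω}
    {B : Set Ω} (hB : MeasurableSet B) {a b : Ω → ℝ} (ha : IntegrableOn a B μ)
    (hb : IntegrableOn b B μ) (hlt : ∀ ω ∈ B, b ω < a ω)
    (hle : ∫ ω in B, a ω ∂μ ≤ ∫ ω in B, b ω ∂μ) : μ B = 0 := by
  have h0 : 0 ≤ᵐ[μ.restrict B] a - b :=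
    (ae_restrict_mem hB).mono fun ω hω => sub_nonneg.2 (hlt ω hω).le
  have h1 : ∫ ω in B, (a - b) ω ∂μ = 0 := by
    refine le_antisymm ?_ (integral_nonneg_of_ae h0)
    simp only [Pi.sub_apply]
    rw [integral_sub ha hb]
    linarith
  have h2 := (integral_eq_zero_iff_of_nonneg_ae h0 (ha.sub hb)).1 h1
  rw [← Measure.restrict_apply_self μ B]
  refine measure_mono_null (fun ω hω => ?_) (ae_iff.1 h2)
  exact (sub_pos.2 (hlt ω hω)).ne'

/-- Let `x` minimize the integral of `‖f - z‖^p` over `A` and over `A \ B`. Then no `y` is closer to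
`f` than `x` throughout `B`, unless `B` is null. -/
theorem measure_eq_zero_of_common_minimizer {Ω : Type*} [MeasurableSpace Ω] {μ : Measure Ω}
    {X : Type*} [NormedAddCommGroup X] [NormedSpace ℝ X] (hX : GateauxDifferentiableNorm X)
    {p : ℝ≥0∞} (hp1 : 1 < p) (hp : p ≠ ∞)
    {f : Ω → X} (hf : MemLp f p μ) {A B : Set Ω} (hA : μ A ≠ ∞) (hBA : B ⊆ A)
    (hB : MeasurableSet B) {x y : X}
    (hx₁ : ∀ z, ∫ ω in A, ‖f ω - x‖ ^ p.toReal ∂μ ≤ ∫ ω in A, ‖f ω - z‖ ^ p.toReal ∂μ)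
    (hx₂ : ∀ z, ∫ ω in A \ B, ‖f ω - x‖ ^ p.toReal ∂μ ≤ ∫ ω in A \ B, ‖f ω - z‖ ^ p.toReal ∂μ)
    (hy : ∀ ω ∈ B, ‖f ω - y‖ < ‖f ω - x‖) : μ B = 0 := by
  have hp0 : p ≠ 0 := (zero_lt_one.trans hp1).ne'
  have hq1 : 1 < p.toReal := by
    simpa using (ENNReal.toReal_lt_toReal ENNReal.one_ne_top hp).2 hp1
  have hB' : μ B ≠ ∞ := ((measure_mono hBA).trans_lt hA.lt_top).ne
  have hAB' : μ (A \ B) ≠ ∞ := ((measure_mono Set.sdiff_subset).trans_lt hA.lt_top).ne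
  have i := fun z => integrableOn_norm_sub_const_rpow hp0 hp hf hB' z
  refine measure_eq_zero_of_setIntegral_le hB (i x) (i y) (fun ω hω =>
    Real.rpow_lt_rpow (norm_nonneg _) (hy ω hω) (by linarith)) ?_
  -- Move `x` towards `y` by a fraction `t`. The cost on `A` does not drop and the cost on `A \ B`
  -- changes by `o(t)`, while convexity bounds the change on `B` by `t` times the difference of the
  -- costs of `y` and `x`. Divide by `t`.
  have hlim := tendsto_setIntegral_quotient hX hp1 hp hf hAB' hx₂ (x - y)
  refine sub_nonpos.1 (ge_of_tendsto hlim (Eventually.of_forall fun n => ?_))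
  set q := p.toReal
  set t : ℝ := ((n : ℝ) + 1)⁻¹ with ht
  have ht0 : 0 < t := by positivity
  have ht1 : t ≤ 1 := inv_le_one_of_one_le₀ (by linarith [n.cast_nonneg (α := ℝ)])
  have hsplit : ∀ z, ∫ ω in A, ‖f ω - z‖ ^ q ∂μ
      = ∫ ω in B, ‖f ω - z‖ ^ q ∂μ + ∫ ω in A \ B, ‖f ω - z‖ ^ q ∂μ := fun z => by
    rw [← integral_inter_add_sdiff hB (integrableOn_norm_sub_const_rpow hp0 hp hf hA z),
      Set.inter_eq_self_of_subset_right hBA]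
  have hBt : ∫ ω in B, ‖f ω - (x - t • (x - y))‖ ^ q ∂μ
      ≤ (1 - t) * ∫ ω in B, ‖f ω - x‖ ^ q ∂μ + t * ∫ ω in B, ‖f ω - y‖ ^ q ∂μ := by
    rw [← integral_const_mul, ← integral_const_mul,
      ← integral_add ((i x).const_mul _) ((i y).const_mul _)]
    refine integral_mono (i _) (((i x).const_mul _).add ((i y).const_mul _)) fun ω => ?_
    have := (convexOn_norm_rpow (X := X) hq1.le).2 (Set.mem_univ (f ω - x))
      (Set.mem_univ (f ω - y)) (sub_nonneg.2 ht1) ht0.le (by ring)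
    have e : (1 - t) • (f ω - x) + t • (f ω - y) = f ω - (x - t • (x - y)) := by module
    simpa only [e, smul_eq_mul] using this
  have h1 := hx₁ (x - t • (x - y))
  rw [hsplit, hsplit] at h1
  have hn : (n : ℝ) + 1 = t⁻¹ := by rw [ht, inv_inv]
  rw [hn, ← div_eq_inv_mul, le_div_iff₀ ht0]
  linarith

/-- For a minimizer, almost no point of `f` has two distinct nearest values. -/
theorem ae_not_tie {Ω : Type*} [MeasurableSpace Ω] {μ : Measure Ω}
    {X : Type*} [NormedAddCommGroup X] [NormedSpace ℝ X] (hX : GateauxDifferentiableNorm X)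
    {p : ℝ≥0∞} (hp1 : 1 < p) (hp : p ≠ ∞) {k : ℕ}
    {f : Ω → X} (hf : MemLp f p μ) (hfm : StronglyMeasurable f) {D : ℝ}
    (hD : ∀ (κ : Ω → Fin k) (y : Fin k → X), Measurable κ → MemLp (fun ω => y (κ ω)) p μ →
      D ≤ ∫ ω, ‖f ω - y (κ ω)‖ ^ p.toReal ∂μ)
    {ι : Ω → Fin k} (hι : Measurable ι) {x : Fin k → X} (hmem : MemLp (fun ω => x (ι ω)) p μ)
    (hmin : ∫ ω, ‖f ω - x (ι ω)‖ ^ p.toReal ∂μ = D) {i j : Fin k} (hij : x i ≠ x j) :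
    ∀ᵐ ω ∂μ, ¬ (‖f ω - x i‖ = ‖f ω - x (ι ω)‖ ∧ ‖f ω - x j‖ = ‖f ω - x (ι ω)‖) := by
  classical
  -- Of two distinct values one is nonzero, and the cell of a nonzero value has finite measure.
  wlog hi : x i ≠ 0 generalizing i j
  · have hj : x j ≠ 0 := by rw [not_not] at hi; rw [hi] at hij; exact hij.symm
    exact (this hij.symm hj).mono fun ω h h' => h h'.symm
  have hne : i ≠ j := fun h => hij (h ▸ rfl)
  have hp0 : p ≠ 0 := (zero_lt_one.trans hp1).ne'
  have hxm : Measurable fun ω => ‖f ω - x (ι ω)‖ :=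
    (hfm.sub (stronglyMeasurable_comp_of_finite x hι)).norm.measurable
  have hxim : ∀ z, Measurable fun ω => ‖f ω - z‖ := fun z =>
    (hfm.sub stronglyMeasurable_const).norm.measurable
  set B : Set Ω := {ω | ‖f ω - x i‖ = ‖f ω - x (ι ω)‖ ∧ ‖f ω - x j‖ = ‖f ω - x (ι ω)‖} with hB
  have hBm : MeasurableSet B :=
    (measurableSet_eq_fun (hxim _) hxm).inter (measurableSet_eq_fun (hxim _) hxm)
  -- A relabelling that keeps all distances is again a minimizer, so `x i` stays optimal on the new
  -- cell.
  have hopt : ∀ κ : Ω → Fin k, Measurable κ → (∀ ω, ‖f ω - x (κ ω)‖ = ‖f ω - x (ι ω)‖) →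
      μ (κ ⁻¹' {i}) ≠ ∞ ∧ ∀ z, ∫ ω in κ ⁻¹' {i}, ‖f ω - x i‖ ^ p.toReal ∂μ
        ≤ ∫ ω in κ ⁻¹' {i}, ‖f ω - z‖ ^ p.toReal ∂μ := by
    intro κ hκ hcost
    have hκm : MemLp (fun ω => x (κ ω)) p μ :=
      memLp_of_norm_sub_le hf hmem
        (stronglyMeasurable_comp_of_finite x hκ).aestronglyMeasurable
        (Eventually.of_forall fun ω => (hcost ω).le)
    have hfin := measure_fiber_ne_top hp0 hp hκm hi
    refine ⟨hfin, fun z => ?_⟩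
    have h := setIntegral_fiber_le hp0 hp hf hD hκ hκm hfin z
    simp only [hcost, hmin, sub_self, add_zero] at h
    exact h
  have hι₁ : Measurable fun ω => if ω ∈ B then i else ι ω := Measurable.ite hBm measurable_const hι
  obtain ⟨hA, hx₁⟩ := hopt _ hι₁ fun ω => by
    by_cases h : ω ∈ B
    · simp only [h, if_true]; exact h.1
    · simp [h]
  have hnull : ∀ y : X, μ (B ∩ {ω | ‖f ω - y‖ < ‖f ω - x i‖}) = 0 := by
    intro y
    -- All ties first go to `i`; handing `B'` over to `j` then removes exactly `B'` from the cell of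
    -- `i`.
    set B' : Set Ω := B ∩ {ω | ‖f ω - y‖ < ‖f ω - x i‖} with hB'
    have hB'm : MeasurableSet B' := hBm.inter (measurableSet_lt (hxim _) (hxim _))
    obtain ⟨-, hx₂⟩ := hopt (fun ω => if ω ∈ B' then j else if ω ∈ B then i else ι ω)
      (Measurable.ite hB'm measurable_const hι₁) fun ω => by
        by_cases h' : ω ∈ B'
        · simp only [h', if_true]; exact h'.1.2
        · by_cases h : ω ∈ B
          · simp only [h, h', if_true, if_false]; exact h.1
          · simp [h, h']
    have e : (fun ω => if ω ∈ B' then j else if ω ∈ B then i else ι ω) ⁻¹' {i}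
        = (fun ω => if ω ∈ B then i else ι ω) ⁻¹' {i} \ B' := by
      ext ω
      by_cases h' : ω ∈ B'
      · simp [h', hne.symm]
      · simp [h']
    rw [e] at hx₂
    refine measure_eq_zero_of_common_minimizer hX hp1 hp hf hA ?_ hB'm hx₁ hx₂
      (fun ω hω => hω.2)
    intro ω hω
    simp [hω.1]
  -- Countably many `y` suffice: at a tie `f ω ≠ x i`, and some `y` of a countable set dense near
  -- the range is closer to `f ω` than `x i` is.
  obtain ⟨c, hc, hcf⟩ := hfm.isSeparable_range
  have hall : ∀ᵐ ω ∂μ, ∀ y ∈ c, ω ∉ B ∩ {ω | ‖f ω - y‖ < ‖f ω - x i‖} :=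
    (ae_ball_iff hc).2 fun y _ => measure_eq_zero_iff_ae_notMem.1 (hnull y)
  filter_upwards [hall] with ω hω hωB
  have hpos : 0 < ‖f ω - x i‖ := by
    refine norm_pos_iff.2 fun h0 => hij ?_
    have : ‖f ω - x j‖ = 0 := by rw [hωB.2, ← hωB.1, h0, norm_zero]
    rw [← sub_eq_zero.1 h0, ← sub_eq_zero.1 (norm_eq_zero.1 this)]
  obtain ⟨y, hyc, hy⟩ := Metric.mem_closure_iff.1 (hcf (Set.mem_range_self ω)) _ hpos
  exact hω y hyc ⟨hωB, by rwa [dist_eq_norm] at hy⟩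

/-! ### Convergence of values and of nearest values -/

theorem tendsto_zero_of_enorm_rpow_mul_le {X : Type*} [NormedAddCommGroup X] {q : ℝ} (hq : 0 < q)
    {x : ℕ → X} {A : ℕ → ℝ≥0∞} {K : ℝ≥0∞} (hK : K ≠ ∞) (h : ∀ n, ‖x n‖ₑ ^ q * A n ≤ K)
    (hA : Tendsto A atTop (𝓝 ∞)) : Tendsto x atTop (𝓝 0) := by
  rw [tendsto_zero_iff_norm_tendsto_zero]
  refine (tendsto_order.2 ⟨fun a ha => Eventually.of_forall fun n => ha.trans_le (norm_nonneg _),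
    fun ε hε => ?_⟩)
  have hε' : ENNReal.ofReal ε ^ q ≠ 0 := by
    simp [hε]
  have hε'' : ENNReal.ofReal ε ^ q ≠ ∞ := by finiteness
  have hlt : K / ENNReal.ofReal ε ^ q < ∞ := ENNReal.div_lt_top hK hε'
  filter_upwards [hA.eventually_const_lt hlt] with n hn
  by_contra! hge
  have h1 : ENNReal.ofReal ε ^ q ≤ ‖x n‖ₑ ^ q := by
    rw [← ofReal_norm]
    gcongr
  rw [ENNReal.div_lt_iff (Or.inl hε') (Or.inl hε''), mul_comm] at hn
  exact (hn.trans_le (by gcongr)).not_ge (h n)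

theorem eventually_norm_le_of_enorm_rpow_mul_le {X : Type*} [NormedAddCommGroup X] {q : ℝ}
    (hq : 0 < q) {x : ℕ → X} {A : ℕ → ℝ≥0∞} {K m₀ : ℝ≥0∞} (hK : K ≠ ∞)
    (h : ∀ n, ‖x n‖ₑ ^ q * A n ≤ K) (hm₀ : m₀ ≠ 0) (hA : ∀ᶠ n in atTop, m₀ ≤ A n) :
    ∀ᶠ n in atTop, ‖x n‖ ≤ ((K / m₀) ^ q⁻¹).toReal := by
  filter_upwards [hA] with n hn
  have h1 : ‖x n‖ₑ ^ q ≤ K / m₀ := by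
    refine (ENNReal.le_div_iff_mul_le (Or.inl hm₀) (Or.inr hK)).2 (le_trans (by gcongr) (h n))
  have h2 : ‖x n‖ₑ ≤ (K / m₀) ^ q⁻¹ := by
    rwa [ENNReal.le_rpow_inv_iff hq]
  rw [← toReal_enorm]
  refine ENNReal.toReal_mono (ENNReal.rpow_lt_top_of_nonneg (by positivity) ?_).ne h2
  exact ENNReal.div_ne_top hK hm₀

/-- The chosen label costs at most `u n` more than `J j₀`, which bounds the limit from above. From
below, it is eventually one of the finitely many labels `J j`, none of which is nearer in the limit
than `b j₀`. -/
theorem tendsto_norm_of_nearly_nearest {X : Type*} [NormedAddCommGroup X] {q : ℝ} (hq : 0 < q)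
    {k : ℕ} {y : X} {a : ℕ → Fin k → X} {b : Fin k → X} {J : Fin k → Fin k}
    (hab : ∀ i, Tendsto (fun n => a n (J i)) atTop (𝓝 (b i))) {i : ℕ → Fin k}
    (hi : ∀ᶠ n in atTop, J (i n) = i n) {u : ℕ → ℝ} (hu : Tendsto u atTop (𝓝 0))
    (hle : ∀ n j, ‖y - a n (i n)‖ ^ q ≤ ‖y - a n j‖ ^ q + u n) {j₀ : Fin k}
    (hj₀ : ∀ j, ‖y - b j₀‖ ≤ ‖y - b j‖) :
    Tendsto (fun n => ‖y - a n (i n)‖) atTop (𝓝 ‖y - b j₀‖) := by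
  have hlim : ∀ j, Tendsto (fun n => ‖y - a n (J j)‖) atTop (𝓝 ‖y - b j‖) := fun j =>
    ((hab j).const_sub y).norm
  -- `u n` may be negative; the maximum with `0` keeps the base of the power nonnegative.
  have hup : Tendsto (fun n => max (‖y - a n (J j₀)‖ ^ q + u n) 0 ^ q⁻¹) atTop
      (𝓝 ‖y - b j₀‖) := by
    have h := (((((hlim j₀).rpow_const (p := q) (Or.inr hq.le)).add hu).max
      (tendsto_const_nhds (x := (0 : ℝ)))).rpow_const (p := q⁻¹) (Or.inr (by positivity)))
    rwa [add_zero, max_eq_left (by positivity), Real.rpow_rpow_inv (norm_nonneg _) hq.ne'] at h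
  refine tendsto_order.2 ⟨fun c hc => ?_, fun c hc => ?_⟩
  · have h : ∀ᶠ n in atTop, ∀ j, c < ‖y - a n (J j)‖ :=
      eventually_all.2 fun j => (hlim j).eventually_const_lt (hc.trans_le (hj₀ j))
    filter_upwards [h, hi] with n h1 h2
    rw [← h2]
    exact h1 _
  · filter_upwards [hup.eventually_lt_const hc] with n hn
    refine lt_of_le_of_lt ?_ hn
    rw [Real.le_rpow_inv_iff_of_pos (norm_nonneg _) (le_max_right _ _) hq]
    exact (hle n (J j₀)).trans (le_max_left _ _)

/-- A label whose limit value is not nearest is eventually never chosen, because its distance has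
the wrong limit. All other labels share the limit `b j₀`, so the labels themselves need not
converge. -/
theorem tendsto_of_nearly_nearest {X : Type*} [NormedAddCommGroup X] {k : ℕ} {y : X}
    {a : ℕ → Fin k → X} {b : Fin k → X} {J : Fin k → Fin k}
    (hab : ∀ i, Tendsto (fun n => a n (J i)) atTop (𝓝 (b i))) {i : ℕ → Fin k}
    (hi : ∀ᶠ n in atTop, J (i n) = i n) {j₀ : Fin k}
    (hlim : Tendsto (fun n => ‖y - a n (i n)‖) atTop (𝓝 ‖y - b j₀‖))
    (hties : ∀ j, ‖y - b j‖ = ‖y - b j₀‖ → b j = b j₀) :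
    Tendsto (fun n => a n (i n)) atTop (𝓝 (b j₀)) := by
  refine tendsto_def.2 fun S hS => ?_
  have h : ∀ᶠ n in atTop, ∀ j, i n = J j → a n (J j) ∈ S := by
    refine eventually_all.2 fun j => ?_
    by_cases hj : ‖y - b j‖ = ‖y - b j₀‖
    · exact ((hab j).eventually_mem (hties j hj ▸ hS)).mono fun n hn _ => hn
    · have h1 : Tendsto (fun n => ‖y - a n (J j)‖ - ‖y - a n (i n)‖) atTop
          (𝓝 (‖y - b j‖ - ‖y - b j₀‖)) := (((hab j).const_sub y).norm).sub hlim
      filter_upwards [h1.eventually_ne (sub_ne_zero.2 hj)] with n hn hij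
      exact absurd (by rw [hij, sub_self]) hn
  filter_upwards [h, hi] with n h1 h2
  have := h1 (i n) h2.symm
  rwa [h2] at this

theorem norm_sub_rpow_eq_integral {Ω : Type*} [MeasurableSpace Ω] {μ : Measure Ω}
    {X : Type*} [NormedAddCommGroup X] {p : ℝ≥0∞} (hp0 : p ≠ 0) (hp : p ≠ ∞)
    {F G : Lp X p μ} {f g : Ω → X} (hf : F =ᵐ[μ] f) (hg : G =ᵐ[μ] g) :
    ‖F - G‖ ^ p.toReal = ∫ ω, ‖f ω - g ω‖ ^ p.toReal ∂μ := by
  have h : (F - G : Lp X p μ) =ᵐ[μ] fun ω => f ω - g ω := by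
    filter_upwards [Lp.coeFn_sub F G, hf, hg] with ω h1 h2 h3
    rw [h1, Pi.sub_apply, h2, h3]
  have hm : MemLp (fun ω => f ω - g ω) p μ := (memLp_congr_ae h).1 (Lp.memLp _)
  rw [← hm.lpNorm_rpow_eq_integral hp0 hp, Lp.norm_def, eLpNorm_congr_ae h, toReal_eLpNorm hm.1]

theorem exists_seq_simpleFunc_tendsto {Ω : Type*} [MeasurableSpace Ω] {μ : Measure Ω}
    {X : Type*} [NormedAddCommGroup X] {p : ℝ≥0∞} (hp : p ≠ ∞) {f : Ω → X} (hf : MemLp f p μ) :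
    ∃ s : ℕ → SimpleFunc Ω X, (∀ j, MemLp (s j) p μ) ∧
      Tendsto (fun j => lpNorm (f - ⇑(s j)) p μ) atTop (𝓝 0) := by
  have h : ∀ j : ℕ, ∃ g : SimpleFunc Ω X,
      eLpNorm (f - ⇑g) p μ < ENNReal.ofReal (1 / ((j : ℝ) + 1)) ∧ MemLp g p μ := fun j =>
    hf.exists_simpleFunc_eLpNorm_sub_lt hp (by simp; positivity)
  choose s hs hsm using h
  refine ⟨s, hsm, squeeze_zero (fun j => lpNorm_nonneg) (fun j => ?_)
    tendsto_one_div_add_atTop_nhds_zero_nat⟩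
  rw [← toReal_eLpNorm (hf.sub (hsm j)).1]
  exact (ENNReal.toReal_mono ENNReal.ofReal_ne_top (hs j).le).trans_eq
    (ENNReal.toReal_ofReal (by positivity))

/-- Along a subsequence, the values on the level sets whose measures do not tend to zero converge,
for any sequence of `k`-valued functions with asymptotically optimal distance to `f`. -/
theorem exists_subseq_values_tendsto {Ω : Type*} [MeasurableSpace Ω] {μ : Measure Ω}
    {X : Type*} [NormedAddCommGroup X] [NormedSpace ℝ X] [CompleteSpace X] [UniformConvexSpace X]
    {p : ℝ≥0∞} (hp1 : 1 < p) (hp : p ≠ ∞) {k : ℕ}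
    {f : Ω → X} (hf : MemLp f p μ) (hfm : StronglyMeasurable f) {D : ℝ}
    (hD : ∀ (κ : Ω → Fin k) (y : Fin k → X), Measurable κ → MemLp (fun ω => y (κ ω)) p μ →
      D ≤ ∫ ω, ‖f ω - y (κ ω)‖ ^ p.toReal ∂μ)
    {ι : ℕ → Ω → Fin k} (hι : ∀ n, Measurable (ι n)) {x : ℕ → Fin k → X}
    (hmem : ∀ n, MemLp (fun ω => x n (ι n ω)) p μ) {K : ℝ≥0∞} (hK : K ≠ ∞)
    (hxK : ∀ n i, ‖x n i‖ₑ ^ p.toReal * μ (ι n ⁻¹' {i}) ≤ K)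
    (hmin : Tendsto (fun n => ∫ ω, ‖f ω - x n (ι n ω)‖ ^ p.toReal ∂μ) atTop (𝓝 D)) :
    ∃ φ : ℕ → ℕ, StrictMono φ ∧ ∀ i, Tendsto (fun n => μ (ι (φ n) ⁻¹' {i})) atTop (𝓝 0) ∨
      ∃ z, Tendsto (fun n => x (φ n) i) atTop (𝓝 z) := by
  have hp0 : p ≠ 0 := (zero_lt_one.trans hp1).ne'
  have hq0 : 0 < p.toReal := ENNReal.toReal_pos hp0 hp
  obtain ⟨s, hs, hsf⟩ := exists_seq_simpleFunc_tendsto hp hf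
  -- `none` records the mass of the cell, `some` its trace on one level set. The index set is
  -- countable, so compactness of the product of copies of `[0, ∞]` gives one subsequence for all of
  -- them.
  let T : ℕ → (Fin k × Option (Σ j, (s j).range)) → ℝ≥0∞ := fun n c =>
    match c with
    | (i, none) => μ (ι n ⁻¹' {i})
    | (i, some ⟨j, y⟩) => μ (ι n ⁻¹' {i} ∩ s j ⁻¹' {(y : X)})
  obtain ⟨a, φ, hφ, ha⟩ := CompactSpace.tendsto_subseq T
  rw [tendsto_pi_nhds] at ha
  refine ⟨φ, hφ, fun i => ?_⟩
  have hm : Tendsto (fun n => μ (ι (φ n) ⁻¹' {i})) atTop (𝓝 (a (i, none))) := ha (i, none)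
  rcases eq_or_ne (a (i, none)) 0 with h0 | h0
  · exact Or.inl (h0 ▸ hm)
  right
  rcases eq_or_ne (a (i, none)) ∞ with htop | htop
  · exact ⟨0, tendsto_zero_of_enorm_rpow_mul_le hq0 hK (fun n => hxK (φ n) i) (htop ▸ hm)⟩
  have hlow : ∀ᶠ n in atTop, a (i, none) / 2 ≤ μ (ι (φ n) ⁻¹' {i}) :=
    (hm.eventually_const_lt (ENNReal.half_lt_self h0 htop)).mono fun n h => h.le
  have hup : ∀ᶠ n in atTop, μ (ι (φ n) ⁻¹' {i}) ≤ a (i, none) + 1 :=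
    (hm.eventually_lt_const (ENNReal.lt_add_right htop one_ne_zero)).mono fun n h => h.le
  have hM : a (i, none) + 1 ≠ ∞ := ENNReal.add_ne_top.2 ⟨htop, ENNReal.one_ne_top⟩
  have hhalf : a (i, none) / 2 ≠ 0 := (ENNReal.half_pos h0).ne'
  refine cauchySeq_tendsto_of_complete (cauchySeq_of_nearly_optimal hp1 hp hf hfm hs hsf hM hup
    hhalf hlow (fun j y hy => ⟨_, ha (i, some ⟨j, y, hy⟩)⟩)
    (eventually_norm_le_of_enorm_rpow_mul_le hq0 hK (fun n => hxK (φ n) i) hhalf hlow)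
    (η := fun n => ∫ ω, ‖f ω - x (φ n) (ι (φ n) ω)‖ ^ p.toReal ∂μ - D) ?_ ?_)
  · simpa using (hmin.comp hφ.tendsto_atTop).sub_const D
  · filter_upwards [hup] with n hn z
    exact setIntegral_fiber_le hp0 hp hf hD (hι _) (hmem _) (hn.trans_lt hM.lt_top).ne z

/-- Along a subsequence, almost every point eventually lies in a level set whose measure does not
tend to zero, and the value there is asymptotically the nearest one. -/
theorem exists_subseq_nearly_nearest {Ω : Type*} [MeasurableSpace Ω] {μ : Measure Ω}
    {X : Type*} [NormedAddCommGroup X] {p : ℝ≥0∞} (hp0 : p ≠ 0) (hp : p ≠ ∞) {k : ℕ} (hk : 1 ≤ k)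
    {f : Ω → X} (hf : MemLp f p μ) (hfm : StronglyMeasurable f) {D : ℝ}
    (hD : ∀ (κ : Ω → Fin k) (y : Fin k → X), Measurable κ → MemLp (fun ω => y (κ ω)) p μ →
      D ≤ ∫ ω, ‖f ω - y (κ ω)‖ ^ p.toReal ∂μ)
    {ι : ℕ → Ω → Fin k} (hι : ∀ n, Measurable (ι n)) {x : ℕ → Fin k → X}
    (hmem : ∀ n, MemLp (fun ω => x n (ι n ω)) p μ)
    (hmin : Tendsto (fun n => ∫ ω, ‖f ω - x n (ι n ω)‖ ^ p.toReal ∂μ) atTop (𝓝 D))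
    (Z : Finset (Fin k)) (hZ : ∀ i ∈ Z, Tendsto (fun n => μ (ι n ⁻¹' {i})) atTop (𝓝 0)) :
    ∃ φ : ℕ → ℕ, StrictMono φ ∧ ∀ᵐ ω ∂μ, (∀ᶠ n in atTop, ι (φ n) ω ∉ Z) ∧
      ∃ u : ℕ → ℝ, Tendsto u atTop (𝓝 0) ∧
        ∀ n j, ‖f ω - x (φ n) (ι (φ n) ω)‖ ^ p.toReal ≤ ‖f ω - x (φ n) j‖ ^ p.toReal + u n := by
  have hq0 : 0 < p.toReal := ENNReal.toReal_pos hp0 hp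
  have hdist : ∀ z, Measurable fun ω => ‖f ω - z‖ := fun z =>
    (hfm.sub stronglyMeasurable_const).norm.measurable
  -- Relabelling by the nearest of the current values gives competitors, so the integral of the
  -- excess `u n` is at most the optimality gap.
  choose κ hκ hκle using fun n => exists_measurable_argmin hk fun i => hdist (x n i)
  have hκmem : ∀ n, MemLp (fun ω => x n (κ n ω)) p μ := fun n =>
    memLp_of_norm_sub_le hf (hmem n)
      (stronglyMeasurable_comp_of_finite (x n) (hκ n)).aestronglyMeasurable
      (Eventually.of_forall fun ω => hκle n ω (ι n ω))
  set u : ℕ → Ω → ℝ := fun n ω =>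
    ‖f ω - x n (ι n ω)‖ ^ p.toReal - ‖f ω - x n (κ n ω)‖ ^ p.toReal with hu
  have hu0 : ∀ n ω, 0 ≤ u n ω := fun n ω =>
    sub_nonneg.2 (Real.rpow_le_rpow (norm_nonneg _) (hκle n ω _) hq0.le)
  have i1 : ∀ n, Integrable (fun ω => ‖f ω - x n (ι n ω)‖ ^ p.toReal) μ := fun n =>
    (hf.sub (hmem n)).integrable_norm_rpow hp0 hp
  have i2 : ∀ n, Integrable (fun ω => ‖f ω - x n (κ n ω)‖ ^ p.toReal) μ := fun n =>
    (hf.sub (hκmem n)).integrable_norm_rpow hp0 hp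
  have iu : ∀ n, Integrable (u n) μ := fun n => (i1 n).sub (i2 n)
  have hS : ∀ n, MeasurableSet (ι n ⁻¹' (Z : Set (Fin k))) := fun n =>
    hι n Z.measurableSet
  set v : ℕ → Ω → ℝ≥0∞ := fun n ω =>
    ENNReal.ofReal (u n ω) + (ι n ⁻¹' (Z : Set (Fin k))).indicator (fun _ => 1) ω with hv
  have hvm : ∀ n, AEMeasurable (v n) μ := fun n =>
    (iu n).1.aemeasurable.ennreal_ofReal.add (measurable_const.indicator (hS n)).aemeasurable
  have hv0 : Tendsto (fun n => ∫⁻ ω, v n ω ∂μ) atTop (𝓝 0) := by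
    have e : ∀ n, ∫⁻ ω, v n ω ∂μ ≤ ENNReal.ofReal (∫ ω, ‖f ω - x n (ι n ω)‖ ^ p.toReal ∂μ - D)
        + ∑ i ∈ Z, μ (ι n ⁻¹' {i}) := fun n => by
      simp only [hv]
      rw [lintegral_add_right _ (measurable_const.indicator (hS n)),
        lintegral_indicator_const (hS n), one_mul,
        ← ofReal_integral_eq_lintegral_ofReal (iu n) (Eventually.of_forall (hu0 n))]
      refine add_le_add (ENNReal.ofReal_le_ofReal ?_) ?_
      · simp only [hu]
        rw [integral_sub (i1 n) (i2 n)]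
        linarith [hD (κ n) (x n) (hκ n) (hκmem n)]
      · refine (measure_mono fun ω hω => ?_).trans (measure_biUnion_finset_le Z _)
        simpa using hω
    refine tendsto_of_tendsto_of_tendsto_of_le_of_le tendsto_const_nhds ?_
      (fun n => zero_le) e
    have h1 := ENNReal.tendsto_ofReal (hmin.sub_const D)
    have h2 := tendsto_finsetSum Z hZ
    simpa using h1.add h2
  obtain ⟨φ, hφ, hae⟩ := exists_subseq_tendsto_zero_ae hvm hv0
  refine ⟨φ, hφ, hae.mono fun ω hω => ⟨?_, fun n => u (φ n) ω, ?_, fun n j => ?_⟩⟩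
  -- The indicator in `v` is `0` or `1`, so `v < 1` excludes labels in `Z`.
  · filter_upwards [hω.eventually_lt_const zero_lt_one] with n hn hmemZ
    refine hn.not_ge ?_
    simp only [hv]
    rw [Set.indicator_of_mem (by simpa using hmemZ)]
    exact le_add_self
  · have h1 : Tendsto (fun n => ENNReal.ofReal (u (φ n) ω)) atTop (𝓝 0) :=
      tendsto_of_tendsto_of_tendsto_of_le_of_le tendsto_const_nhds hω
        (fun n => zero_le) (fun n => le_self_add)
    have h2 := (ENNReal.tendsto_toReal ENNReal.zero_ne_top).comp h1
    refine h2.congr fun n => ?_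
    simp [ENNReal.toReal_ofReal (hu0 _ _)]
  · have := Real.rpow_le_rpow (norm_nonneg _) (hκle (φ n) ω j) hq0.le
    simp only [hu]
    linarith

/-! ### Convergence of minimizing sequences -/

theorem IsMinimizingSeq.exists_subseq_tendsto_minimizer {Ω : Type*} [MeasurableSpace Ω]
    {μ : Measure Ω} {X : Type*} [NormedAddCommGroup X] [NormedSpace ℝ X] [CompleteSpace X]
    [UniformConvexSpace X] (hX : GateauxDifferentiableNorm X)
    {p : ℝ≥0∞} [Fact (1 ≤ p)] (hp1 : 1 < p) (hp : p ≠ ∞) {k : ℕ} (hk : 1 ≤ k)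
    {f : Lp X p μ} {h : ℕ → Lp X p μ} (hh : IsMinimizingSeq (kValuedSimple X p μ k) f h) :
    ∃ (φ : ℕ → ℕ) (g : Lp X p μ), StrictMono φ ∧
      IsMinimizer (kValuedSimple X p μ k) f g ∧ Tendsto (fun n => h (φ n)) atTop (𝓝 g) := by
  classical
  have hp0 : p ≠ 0 := (zero_lt_one.trans hp1).ne'
  have hq1 : 1 < p.toReal := by
    simpa using (ENNReal.toReal_lt_toReal ENNReal.one_ne_top hp).2 hp1
  have hq0 : 0 < p.toReal := by linarith
  obtain ⟨hmemG, hlim⟩ := hh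
  set d := Metric.infDist f (kValuedSimple X p μ k) with hd
  have hd0 : 0 ≤ d := Metric.infDist_nonneg
  have hf := Lp.memLp f
  have hfm := Lp.stronglyMeasurable f
  have hmk : ∀ (κ : Ω → Fin k) (y : Fin k → X), Measurable κ →
      ∀ hy : MemLp (fun ω => y (κ ω)) p μ, hy.toLp _ ∈ kValuedSimple X p μ k := fun κ y hκ hy =>
    mem_kValuedSimple_iff.2 ⟨κ, y, hκ, hy.coeFn_toLp⟩
  have hle : ∀ g ∈ kValuedSimple X p μ k, d ≤ ‖f - g‖ := fun g hg => by
    rw [← dist_eq_norm]; exact Metric.infDist_le_dist_of_mem hg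
  have hD : ∀ (κ : Ω → Fin k) (y : Fin k → X), Measurable κ → MemLp (fun ω => y (κ ω)) p μ →
      d ^ p.toReal ≤ ∫ ω, ‖f ω - y (κ ω)‖ ^ p.toReal ∂μ := fun κ y hκ hy => by
    rw [← norm_sub_rpow_eq_integral hp0 hp (ae_eq_refl f) hy.coeFn_toLp]
    exact Real.rpow_le_rpow hd0 (hle _ (hmk κ y hκ hy)) hq0.le
  choose ι x hι hx using fun n => mem_kValuedSimple_iff.1 (hmemG n)
  have hmem : ∀ n, MemLp (fun ω => x n (ι n ω)) p μ := fun n =>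
    (memLp_congr_ae (hx n)).1 (Lp.memLp (h n))
  have hcost : ∀ n, ‖f - h n‖ ^ p.toReal = ∫ ω, ‖f ω - x n (ι n ω)‖ ^ p.toReal ∂μ := fun n =>
    norm_sub_rpow_eq_integral hp0 hp (ae_eq_refl f) (hx n)
  have hmin : Tendsto (fun n => ∫ ω, ‖f ω - x n (ι n ω)‖ ^ p.toReal ∂μ) atTop
      (𝓝 (d ^ p.toReal)) := by
    simpa only [hcost] using hlim.rpow_const (p := p.toReal) (Or.inr hq0.le)
  obtain ⟨C, hC⟩ := hlim.bddAbove_range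
  have hxK : ∀ n i, ‖x n i‖ₑ ^ p.toReal * μ (ι n ⁻¹' {i})
      ≤ ENNReal.ofReal (‖f‖ + C) ^ p.toReal := fun n i => by
    refine (enorm_rpow_mul_measure_fiber_le hp0 hp (hmem n) i).trans ?_
    rw [← eLpNorm_congr_ae (hx n), ← Lp.enorm_def, ← ofReal_norm]
    gcongr
    have h1 : ‖f - h n‖ ≤ C := hC (Set.mem_range_self n)
    have h2 := norm_sub_le f (f - h n)
    rw [sub_sub_cancel] at h2
    linarith
  obtain ⟨φ, hφ, hφv⟩ := exists_subseq_values_tendsto hp1 hp hf hfm hD hι hmem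
    (ENNReal.rpow_lt_top_of_nonneg hq0.le ENNReal.ofReal_ne_top).ne hxK hmin
  set Z : Finset (Fin k) :=
    {i | Tendsto (fun n => μ (ι (φ n) ⁻¹' {i})) atTop (𝓝 0)} with hZ
  obtain ⟨ψ, hψ, hψae⟩ := exists_subseq_nearly_nearest hp0 hp hk hf hfm hD (fun n => hι (φ n))
    (fun n => hmem (φ n)) (hmin.comp hφ.tendsto_atTop) Z (fun i hi => by simpa [hZ] using hi)
  have hθ : StrictMono (φ ∘ ψ) := hφ.comp hψ
  rcases eq_or_ne μ 0 with rfl | hμ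
  · have hsub : ∀ a b : Lp X p (0 : Measure Ω), a = b := fun a b => Lp.ext (by simp [EventuallyEq])
    refine ⟨id, h 0, strictMono_id, ⟨hmemG 0, ?_⟩, ?_⟩
    · refine tendsto_nhds_unique ?_ hlim
      simp only [hsub _ (h 0)]
      exact tendsto_const_nhds
    · simp only [hsub _ (h 0)]
      exact tendsto_const_nhds
  -- Since `μ ≠ 0`, some point eventually has labels outside `Z`, so not every cell has vanishing
  -- mass.
  obtain ⟨i₀, hi₀⟩ : ∃ i₀, i₀ ∉ Z := by
    have : (ae μ).NeBot := ae_neBot.2 hμ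
    obtain ⟨ω, hω, -⟩ := hψae.exists
    obtain ⟨n, hn⟩ := hω.exists
    exact ⟨_, hn⟩
  -- Values on vanishing cells need not converge; such labels borrow the value of `i₀`, so that
  -- every label has a limit value.
  set J : Fin k → Fin k := fun i => if i ∈ Z then i₀ else i with hJ
  have hJZ : ∀ i, J i ∉ Z := fun i => by
    by_cases hi : i ∈ Z
    · simpa [hJ, hi] using hi₀
    · simp [hJ, hi]
  have hz : ∀ i, ∃ z, Tendsto (fun n => x (φ (ψ n)) (J i)) atTop (𝓝 z) := fun i => by
    obtain ⟨z, hz⟩ := (hφv (J i)).resolve_left (by simpa [hZ] using hJZ i)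
    exact ⟨z, hz.comp hψ.tendsto_atTop⟩
  choose b hb using hz
  obtain ⟨κ, hκ, hκle⟩ := exists_measurable_argmin hk (a := fun i ω => ‖f ω - b i‖) fun i =>
    (hfm.sub stronglyMeasurable_const).norm.measurable
  have hJι : ∀ᵐ ω ∂μ, ∀ᶠ n in atTop, J (ι (φ (ψ n)) ω) = ι (φ (ψ n)) ω :=
    hψae.mono fun ω hω => hω.1.mono fun n hn => by simp [hJ, hn]
  have hnorm : ∀ᵐ ω ∂μ, Tendsto (fun n => ‖f ω - x (φ (ψ n)) (ι (φ (ψ n)) ω)‖) atTop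
      (𝓝 ‖f ω - b (κ ω)‖) := by
    filter_upwards [hψae, hJι] with ω ⟨_, u, hu, hule⟩ h2
    exact tendsto_norm_of_nearly_nearest hq0 hb h2 hu hule (hκle ω)
  have hlimθ : Tendsto (fun n => ‖f - h (φ (ψ n))‖) atTop (𝓝 d) := hlim.comp hθ.tendsto_atTop
  have hbsm : AEStronglyMeasurable (fun ω => b (κ ω)) μ :=
    (stronglyMeasurable_comp_of_finite b hκ).aestronglyMeasurable
  -- Only the distances to `f` are known to converge a.e. so far, but Fatou needs no more; it also
  -- gives membership in `L^p`.
  have hfatou : eLpNorm (fun ω => f ω - b (κ ω)) p μ ≤ ENNReal.ofReal d := by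
    rw [← eLpNorm_norm]
    refine (Lp.eLpNorm_lim_le_liminf_eLpNorm (fun n => (hf.1.sub (hmem (φ (ψ n))).1).norm) _
      hnorm).trans_eq ?_
    refine Tendsto.liminf_eq ((ENNReal.tendsto_ofReal hlimθ).congr fun n => ?_)
    rw [ofReal_norm, Lp.enorm_def, ← eLpNorm_norm]
    refine eLpNorm_congr_ae ?_
    filter_upwards [Lp.coeFn_sub f (h (φ (ψ n))), hx (φ (ψ n))] with ω h1 h2
    rw [h1, Pi.sub_apply, h2]
    rfl
  have hdiff : MemLp (fun ω => f ω - b (κ ω)) p μ :=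
    ⟨hf.1.sub hbsm, hfatou.trans_lt ENNReal.ofReal_lt_top⟩
  have hbmem : MemLp (fun ω => b (κ ω)) p μ := by
    have := hf.sub hdiff
    refine (memLp_congr_ae (Eventually.of_forall fun ω => ?_)).1 this
    simp
  have hgmin : ∫ ω, ‖f ω - b (κ ω)‖ ^ p.toReal ∂μ = d ^ p.toReal := by
    refine le_antisymm ?_ (hD κ b hκ hbmem)
    rw [← hdiff.lpNorm_rpow_eq_integral hp0 hp, ← toReal_eLpNorm hdiff.1]
    refine Real.rpow_le_rpow ENNReal.toReal_nonneg ?_ hq0.le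
    exact (ENNReal.toReal_mono ENNReal.ofReal_ne_top hfatou).trans_eq (ENNReal.toReal_ofReal hd0)
  have hties : ∀ᵐ ω ∂μ, ∀ j, ‖f ω - b j‖ = ‖f ω - b (κ ω)‖ → b j = b (κ ω) := by
    have hall : ∀ᵐ ω ∂μ, ∀ i j, b i ≠ b j →
        ¬ (‖f ω - b i‖ = ‖f ω - b (κ ω)‖ ∧ ‖f ω - b j‖ = ‖f ω - b (κ ω)‖) := by
      refine ae_all_iff.2 fun i => ae_all_iff.2 fun j => ?_
      by_cases hij : b i = b j
      · simp [hij]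
      · exact (ae_not_tie hX hp1 hp hf hfm hD hκ hbmem hgmin hij).mono fun ω h _ => h
    filter_upwards [hall] with ω hω j hj
    by_contra hne
    exact hω j (κ ω) hne ⟨hj, rfl⟩
  have hptw : ∀ᵐ ω ∂μ, Tendsto (fun n => x (φ (ψ n)) (ι (φ (ψ n)) ω)) atTop (𝓝 (b (κ ω))) := by
    filter_upwards [hJι, hnorm, hties] with ω h1 h2 h3
    exact tendsto_of_nearly_nearest hb h1 h2 h3
  refine ⟨φ ∘ ψ, hbmem.toLp _, hθ, ⟨hmk κ b hκ hbmem, ?_⟩, ?_⟩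
  · rw [← Real.rpow_left_inj (norm_nonneg _) hd0 hq0.ne',
      norm_sub_rpow_eq_integral hp0 hp (ae_eq_refl f) hbmem.coeFn_toLp, hgmin]
  · have hmem' : ∀ n, MemLp (fun ω => f ω - x (φ (ψ n)) (ι (φ (ψ n)) ω)) p μ := fun n =>
      hf.sub (hmem _)
    have hL := tendsto_integral_norm_sub_rpow (μ := μ) hq1.le (fun n => (hmem' n).1) hdiff.1
      (fun n => (hmem' n).integrable_norm_rpow hp0 hp) (hdiff.integrable_norm_rpow hp0 hp)
      (hptw.mono fun ω hω => hω.const_sub (f ω))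
      (by rw [hgmin]; exact hmin.comp hθ.tendsto_atTop)
    rw [tendsto_iff_norm_sub_tendsto_zero]
    have hR := hL.rpow_const (p := p.toReal⁻¹) (Or.inr (by positivity))
    rw [Real.zero_rpow (by positivity)] at hR
    refine hR.congr fun n => ?_
    rw [← Real.rpow_rpow_inv (norm_nonneg (h ((φ ∘ ψ) n) - hbmem.toLp _)) hq0.ne',
      norm_sub_rpow_eq_integral hp0 hp (hx _) hbmem.coeFn_toLp]
    congr 2
    ext ω
    rw [sub_sub_sub_cancel_left, norm_sub_rev]
    rfl

theorem corollary3 {Ω : Type*} [MeasurableSpace Ω] (μ : Measure Ω)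
    {X : Type*} [NormedAddCommGroup X] [NormedSpace ℝ X] [CompleteSpace X]
    [UniformConvexSpace X] (hX : GateauxDifferentiableNorm X)
    (p : ℝ≥0∞) [Fact (1 ≤ p)] (hp_one : 1 < p) (hp_top : p < ∞) (k : ℕ) (hk : 1 ≤ k) :
    ApproximativelyNormCompact (kValuedSimple X p μ k) ∧
      ∀ (f : Lp X p μ) (h : ℕ → Lp X p μ), IsMinimizingSeq (kValuedSimple X p μ k) f h →
        ∃ (φ : ℕ → ℕ) (g : Lp X p μ), StrictMono φ ∧
          IsMinimizer (kValuedSimple X p μ k) f g ∧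
          Tendsto (fun n => h (φ n)) atTop (𝓝 g) := by
  refine ⟨fun f h hh => ?_, fun f h hh =>
    hh.exists_subseq_tendsto_minimizer hX hp_one hp_top.ne hk⟩
  obtain ⟨φ, g, hφ, hg, hlim⟩ := hh.exists_subseq_tendsto_minimizer hX hp_one hp_top.ne hk
  exact ⟨ℕ, inferInstance, inferInstance, inferInstance, φ, hφ.tendsto_atTop, g, hg.1, hlim⟩
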